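/- Let $\mathcal T$ be a finite double groupoid, with sets $\mathcal P$ of points, $\mathcal H$ of horizontal arrows, $\mathcal V$ of vertical arrows and $\mathcal B$ of boxes. A box $A$ has top and bottom sides $t(A), b(A)\in\mathcal H$ and left and right sides $l(A), r(A)\in\mathcal V$; write $tr(A)$, $br(A)$, $bl(A)$ for its top right, bottom right and bottom left vertices, $A^v$ for its inverse for vertical composition, and $XY$ for horizontal composition. Identify $\mathcal H$ and $\mathcal V$ with sets of boxes through the vertical, respectively horizontal, identity boxes. Let $\vartheta:\mathcal P\to\mathbb R_{>0}$ satisfy the normalization condition $$\sum_{A\in\mathcal B:\ t(A)=x,\ r(A)=g}\vartheta(bl(A))=1$$ for all $x\in\mathcal H$, $g\in\mathcal V$ such that the right end of $x$ is the top end of $g$. Let $\mathbb C^{(\vartheta)}\mathcal T$ be the complex vector space with basis $\mathcal B$, with the product in which $A.B$ is the vertical composition of $A$ (above) and $B$ (below) if $b(A)=t(B)$ and $A.B=0$ otherwise, the unit $1=\sum_{x\in\mathcal H}x$, the comultiplication $\Delta(A)=\sum_{XY=A}\vartheta(bl(Y))\,X\otimes Y$, and the counit $\epsilon(A)=\vartheta(bl(A))^{-1}$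 if $A\in\mathcal V$ and $\epsilon(A)=0$ otherwise. Then $\mathbb C^{(\vartheta)}\mathcal T$ is a $C^*$-quantum groupoid with respect to the conjugate-linear involution determined by $$A^*=\lambda(A)A^v,\qquad \lambda(A)=\frac{\vartheta(tr(A))}{\vartheta(br(A))}\qquad(A\in\mathcal B);$$ that is, it is a finite-dimensional weak Hopf algebra over $\mathbb C$, $*$ makes it a $*$-algebra with $\Delta(a^*)=\Delta(a)^{*\otimes *}$ for all $a$, and it has a faithful $*$-representation on a Hilbert space. Moreover, let $\varphi:\mathbb C^{(\vartheta)}\mathcal T\to\mathbb C$ be the linear functional with $\varphi(A)=1$ if $A\in\mathcal H$ and $\varphi(A)=0$ for every other box $A$. Then $\varphi$ is positive, i.e. $\varphi(a^*a)\ge 0$ for all $a$; there is a unique inner product on $\mathbb C^{(\vartheta)}\mathcal T$, conjugate-linear in the first variable, with $(A\vert B)=\varphi(A^*.B)$ for all boxes $A,B$; it satisfies $(a\vert b)=\varphi(a^*b)$ for all $a,b$, and left multiplication is a $*$-representation for it: $(ax\vert y)=(x\vert a^*y)$ for all $a,x,y$. -/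

import Mathlib

open scoped TensorProduct

universe u

/-! ### Weak Hopf algebras -/

section WeakHopf

variable (k : Type*) {A : Type*} [Field k] [Ring A] [Algebra k A] [Coalgebra k A]

open Coalgebra

/-- The source map `ε_s(h) = (id ⊗ ε)((1 ⊗ h) Δ(1))`. -/
noncomputable def sourceMap (h : A) : A :=
  TensorProduct.rid k A ((counit (R := k) (A := A)).lTensor A
    (((1 : A) ⊗ₜ[k] h) * comul (R := k) (1 : A)))

/-- The target map `ε_t(h) = (ε ⊗ id)(Δ(1) (h ⊗ 1))`. -/
noncomputable def targetMap (h : A) : A :=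
  TensorProduct.lid k A ((counit (R := k) (A := A)).rTensor A
    (comul (R := k) (1 : A) * (h ⊗ₜ[k] (1 : A))))

variable (A)

/-- A weak bialgebra: an algebra and coalgebra with multiplicative comultiplication, weakly
comultiplicative unit and weakly multiplicative counit. -/
structure IsWeakBialgebra : Prop where
  comul_mul : ∀ a b : A, comul (R := k) (a * b) = comul (R := k) a * comul (R := k) b
  /-- `Δ²(1) = (Δ(1) ⊗ 1)(1 ⊗ Δ(1))` -/
  comul_one : (comul (R := k)).lTensor A (comul (R := k) (1 : A)) =
    TensorProduct.assoc k A A A (comul (R := k) (1 : A) ⊗ₜ[k] (1 : A)) *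
      ((1 : A) ⊗ₜ[k] comul (R := k) (1 : A))
  /-- `Δ²(1) = (1 ⊗ Δ(1))(Δ(1) ⊗ 1)` -/
  comul_one' : (comul (R := k)).lTensor A (comul (R := k) (1 : A)) =
    ((1 : A) ⊗ₜ[k] comul (R := k) (1 : A)) *
      TensorProduct.assoc k A A A (comul (R := k) (1 : A) ⊗ₜ[k] (1 : A))
  /-- `ε(abc) = ε(ab₁) ε(b₂c)` -/
  counit_mul : ∀ a b c : A, counit (R := k) (a * b * c) =
    LinearMap.mul' k k (TensorProduct.map (counit (R := k) ∘ₗ LinearMap.mulLeft k a)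
      (counit (R := k) ∘ₗ LinearMap.mulRight k c) (comul (R := k) b))
  /-- `ε(abc) = ε(ab₂) ε(b₁c)` -/
  counit_mul' : ∀ a b c : A, counit (R := k) (a * b * c) =
    LinearMap.mul' k k (TensorProduct.map (counit (R := k) ∘ₗ LinearMap.mulRight k c)
      (counit (R := k) ∘ₗ LinearMap.mulLeft k a) (comul (R := k) b))

/-- A weak Hopf algebra, or quantum groupoid: a weak bialgebra with an antipode. -/
structure IsWeakHopfAlgebra : Prop extends IsWeakBialgebra k A where
  exists_antipode : ∃ S : A →ₗ[k] A,
    (∀ h : A, LinearMap.mul' k A (S.lTensor A (comul (R := k) h)) = targetMap k h) ∧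
    (∀ h : A, LinearMap.mul' k A (S.rTensor A (comul (R := k) h)) = sourceMap k h) ∧
    (∀ h : A, LinearMap.mul' k A (TensorProduct.map S
      (LinearMap.mul' k A ∘ₗ S.lTensor A ∘ₗ comul (R := k)) (comul (R := k) h)) = S h)

end WeakHopf

/-- A `C*`-quantum groupoid: a finite-dimensional complex weak Hopf algebra which is a `*`-algebra,
whose comultiplication is compatible with the involutions (the one of `A ⊗ A` being `* ⊗ *`), and
which has a faithful `*`-representation on a Hilbert space. -/
structure IsCStarQuantumGroupoid (A : Type u) [Ring A] [Algebra ℂ A] [Coalgebra ℂ A] [StarRing A]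
    [StarModule ℂ A] : Prop extends IsWeakHopfAlgebra ℂ A where
  finiteDimensional : FiniteDimensional ℂ A
  comul_star : ∀ a : A,
    Coalgebra.comul (R := ℂ) (star a) = star (Coalgebra.comul (R := ℂ) a)
  exists_faithful : ∃ (K : Type u) (_ : NormedAddCommGroup K) (_ : InnerProductSpace ℂ K)
    (_ : CompleteSpace K) (π : A →⋆ₐ[ℂ] (K →L[ℂ] K)), Function.Injective π

/-! ### Groupoids and double groupoids -/

/-- A groupoid with set of arrows `G` and set of objects `P`; compositions are written from left to
right, so `comp f g` is defined when the target of `f` is the source of `g`. -/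
structure ArrowGroupoid (G P : Type*) where
  src : G → P
  tgt : G → P
  one : P → G
  inv : G → G
  comp : (f g : G) → tgt f = src g → G
  src_one : ∀ p, src (one p) = p
  tgt_one : ∀ p, tgt (one p) = p
  src_inv : ∀ f, src (inv f) = tgt f
  tgt_inv : ∀ f, tgt (inv f) = src f
  src_comp : ∀ f g h, src (comp f g h) = src f
  tgt_comp : ∀ f g h, tgt (comp f g h) = tgt g
  one_comp : ∀ f, comp (one (src f)) f (tgt_one _) = f
  comp_one : ∀ f, comp f (one (tgt f)) (src_one _).symm = f
  inv_comp : ∀ f, comp (inv f) f (tgt_inv f) = one (tgt f)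
  comp_inv : ∀ f, comp f (inv f) (src_inv f).symm = one (src f)
  assoc : ∀ f g k (h₁ : tgt f = src g) (h₂ : tgt g = src k),
    comp (comp f g h₁) k ((tgt_comp f g h₁).trans h₂) =
      comp f (comp g k h₂) (h₁.trans (src_comp g k h₂).symm)

/-- A double groupoid, that is, a groupoid object in groupoids, as four related groupoids:
points `P`, horizontal arrows `H` (source = left end, target = right end), vertical arrows `V`
(source = top end, target = bottom end) and boxes `B`.  Boxes compose horizontally
(over `V`, source = left side, target = right side) and vertically
(over `H`, source = top side, target = bottom side). -/
structure DoubleGroupoid (P V H B : Type*) where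
  /-- the groupoid of horizontal arrows -/
  hor : ArrowGroupoid H P
  /-- the groupoid of vertical arrows -/
  ver : ArrowGroupoid V P
  /-- the horizontal composition of boxes -/
  boxH : ArrowGroupoid B V
  /-- the vertical composition of boxes -/
  boxV : ArrowGroupoid B H
  -- the sides of a box have matching vertices
  topLeft : ∀ A, hor.src (boxV.src A) = ver.src (boxH.src A)
  topRight : ∀ A, hor.tgt (boxV.src A) = ver.src (boxH.tgt A)
  bottomLeft : ∀ A, hor.src (boxV.tgt A) = ver.tgt (boxH.src A)
  bottomRight : ∀ A, hor.tgt (boxV.tgt A) = ver.tgt (boxH.tgt A)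
  -- the top and bottom sides are functors from horizontal composition of boxes to `hor`
  top_comp : ∀ A C (h : boxH.tgt A = boxH.src C) (h' : hor.tgt (boxV.src A) = hor.src (boxV.src C)),
    boxV.src (boxH.comp A C h) = hor.comp (boxV.src A) (boxV.src C) h'
  bottom_comp : ∀ A C (h : boxH.tgt A = boxH.src C)
    (h' : hor.tgt (boxV.tgt A) = hor.src (boxV.tgt C)),
    boxV.tgt (boxH.comp A C h) = hor.comp (boxV.tgt A) (boxV.tgt C) h'
  top_one : ∀ g, boxV.src (boxH.one g) = hor.one (ver.src g)
  bottom_one : ∀ g, boxV.tgt (boxH.one g) = hor.one (ver.tgt g)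
  -- the left and right sides are functors from vertical composition of boxes to `ver`
  left_comp : ∀ A C (h : boxV.tgt A = boxV.src C) (h' : ver.tgt (boxH.src A) = ver.src (boxH.src C)),
    boxH.src (boxV.comp A C h) = ver.comp (boxH.src A) (boxH.src C) h'
  right_comp : ∀ A C (h : boxV.tgt A = boxV.src C)
    (h' : ver.tgt (boxH.tgt A) = ver.src (boxH.tgt C)),
    boxH.tgt (boxV.comp A C h) = ver.comp (boxH.tgt A) (boxH.tgt C) h'
  left_one : ∀ x, boxH.src (boxV.one x) = ver.one (hor.src x)
  right_one : ∀ x, boxH.tgt (boxV.one x) = ver.one (hor.tgt x)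
  -- the identity boxes are functorial
  one_comp_hor : ∀ x y (h : hor.tgt x = hor.src y)
    (h' : boxH.tgt (boxV.one x) = boxH.src (boxV.one y)),
    boxV.one (hor.comp x y h) = boxH.comp (boxV.one x) (boxV.one y) h'
  one_comp_ver : ∀ f g (h : ver.tgt f = ver.src g)
    (h' : boxV.tgt (boxH.one f) = boxV.src (boxH.one g)),
    boxH.one (ver.comp f g h) = boxV.comp (boxH.one f) (boxH.one g) h'
  one_one : ∀ p, boxV.one (hor.one p) = boxH.one (ver.one p)
  -- the interchange law
  -- (the compositions on both sides exist, by the four functoriality laws above)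
  interchange : ∀ A C D E (h₁ : boxH.tgt A = boxH.src C) (h₂ : boxH.tgt D = boxH.src E)
    (h₃ : boxV.tgt A = boxV.src D) (h₄ : boxV.tgt C = boxV.src E)
    (h₅ : boxV.tgt (boxH.comp A C h₁) = boxV.src (boxH.comp D E h₂))
    (h₆ : boxH.tgt (boxV.comp A D h₃) = boxH.src (boxV.comp C E h₄)),
    boxV.comp (boxH.comp A C h₁) (boxH.comp D E h₂) h₅ =
      boxH.comp (boxV.comp A D h₃) (boxV.comp C E h₄) h₆

namespace DoubleGroupoid

variable {P V H B : Type*} (T : DoubleGroupoid P V H B)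

/-- the top right vertex of a box -/
def tr (A : B) : P := T.hor.tgt (T.boxV.src A)

/-- the bottom right vertex of a box -/
def br (A : B) : P := T.hor.tgt (T.boxV.tgt A)

/-- the bottom left vertex of a box -/
def bl (A : B) : P := T.hor.src (T.boxV.tgt A)

/-- `HComp X Y A`: the boxes `X`, `Y` are horizontally composable, with composition `A`. -/
def HComp (X Y A : B) : Prop :=
  ∃ h : T.boxH.tgt X = T.boxH.src Y, T.boxH.comp X Y h = A

/-- `A` is the vertical identity box of a horizontal arrow, i.e. `A` belongs to `H ⊆ B`. -/
def IsVerticalIdentity (A : B) : Prop := ∃ x : H, A = T.boxV.one x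

/-- `A` is the horizontal identity box of a vertical arrow, i.e. `A` belongs to `V ⊆ B`. -/
def IsHorizontalIdentity (A : B) : Prop := ∃ g : V, A = T.boxH.one g

open Classical in
/-- The normalization condition on `ϑ`: for every vertical arrow `g` and horizontal arrow `x`
with `r x = t g`, the values of `ϑ` at the bottom left vertices of the boxes with top side `x` and
right side `g` add up to `1`. -/
def Normalized [Fintype B] {k : Type*} [Field k] (ϑ : P → kˣ) : Prop :=
  ∀ (g : V) (x : H), T.ver.src g = T.hor.tgt x →
    ∑ A : B, (if T.boxV.src A = x ∧ T.boxH.tgt A = g then (ϑ (T.bl A) : k) else 0) = 1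

/-- The character `λ(A) = ϑ(tr A) / ϑ(br A)` of the vertical composition groupoid of boxes. -/
def character {k : Type*} [Field k] (ϑ : P → kˣ) (A : B) : k := ϑ (T.tr A) / ϑ (T.br A)

/-! ### The algebra and coalgebra of boxes -/

/-- The vector space with basis the set of boxes, to be endowed with the vertical
groupoid algebra structure and with the horizontal coalgebra structure deformed by `ϑ`. -/
def BoxAlgebra {k : Type*} [Field k] (_T : DoubleGroupoid P V H B) (_ϑ : P → kˣ) : Type _ :=
  B →₀ k

namespace BoxAlgebra

variable {k : Type*} [Field k] (ϑ : P → kˣ)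

noncomputable instance : AddCommGroup (BoxAlgebra T ϑ) := inferInstanceAs (AddCommGroup (B →₀ k))

noncomputable instance : Module k (BoxAlgebra T ϑ) := inferInstanceAs (Module k (B →₀ k))

/-- the basis of boxes -/
noncomputable def basis : Module.Basis B k (BoxAlgebra T ϑ) :=
  Module.Basis.ofRepr (LinearEquiv.refl k (B →₀ k))

/-- a box, as an element of the algebra -/
noncomputable def box (A : B) : BoxAlgebra T ϑ := basis T ϑ A

open Classical in
/-- The product of two boxes: their vertical composition if it exists, and zero otherwise. -/
noncomputable def mulBox (A C : B) : BoxAlgebra T ϑ :=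
  if h : T.boxV.tgt A = T.boxV.src C then box T ϑ (T.boxV.comp A C h) else 0

/-- The bilinear extension of the product of boxes. -/
noncomputable def mulMap : BoxAlgebra T ϑ →ₗ[k] BoxAlgebra T ϑ →ₗ[k] BoxAlgebra T ϑ :=
  (basis T ϑ).constr k fun A => (basis T ϑ).constr k fun C => mulBox T ϑ A C

theorem mulMap_box (A C : B) : mulMap T ϑ (box T ϑ A) (box T ϑ C) = mulBox T ϑ A C := by
  simp [mulMap, box, Module.Basis.constr_basis]

/-- The unit element, the sum of all vertical identities. -/
noncomputable def unitElt [Fintype H] : BoxAlgebra T ϑ := ∑ x : H, box T ϑ (T.boxV.one x)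

theorem unitElt_mul [Fintype H] (a : BoxAlgebra T ϑ) : mulMap T ϑ (unitElt T ϑ) a = a := by
  have : mulMap T ϑ (unitElt T ϑ) = LinearMap.id := by
    refine (basis T ϑ).ext fun A => ?_
    change mulMap T ϑ (unitElt T ϑ) (box T ϑ A) = box T ϑ A
    rw [unitElt, map_sum, LinearMap.sum_apply, Finset.sum_eq_single (T.boxV.src A)]
    · rw [mulMap_box, mulBox, dif_pos (T.boxV.tgt_one _), T.boxV.one_comp]
    · intro x _ hx
      rw [mulMap_box, mulBox, dif_neg]
      rw [T.boxV.tgt_one]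
      exact hx
    · simp
  rw [this]; rfl

theorem mul_unitElt [Fintype H] (a : BoxAlgebra T ϑ) : mulMap T ϑ a (unitElt T ϑ) = a := by
  have : (mulMap T ϑ).flip (unitElt T ϑ) = LinearMap.id := by
    refine (basis T ϑ).ext fun A => ?_
    change mulMap T ϑ (box T ϑ A) (unitElt T ϑ) = box T ϑ A
    rw [unitElt, map_sum, Finset.sum_eq_single (T.boxV.tgt A)]
    · rw [mulMap_box, mulBox, dif_pos (T.boxV.src_one _).symm, T.boxV.comp_one]
    · intro x _ hx
      rw [mulMap_box, mulBox, dif_neg]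
      rw [T.boxV.src_one]
      exact hx.symm
    · simp
  exact LinearMap.congr_fun this a

theorem mulMap_box_assoc (A C D : B) :
    mulMap T ϑ (mulMap T ϑ (box T ϑ A) (box T ϑ C)) (box T ϑ D) =
      mulMap T ϑ (box T ϑ A) (mulMap T ϑ (box T ϑ C) (box T ϑ D)) := by
  rw [mulMap_box, mulMap_box]
  by_cases h₁ : T.boxV.tgt A = T.boxV.src C <;> by_cases h₂ : T.boxV.tgt C = T.boxV.src D
  · have h₃ := (T.boxV.tgt_comp A C h₁).trans h₂
    have h₄ := h₁.trans (T.boxV.src_comp C D h₂).symm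
    simp only [mulBox, dif_pos h₁, dif_pos h₂, mulMap_box, dif_pos h₃, dif_pos h₄]
    rw [T.boxV.assoc]
  · have h₃ : ¬ T.boxV.tgt (T.boxV.comp A C h₁) = T.boxV.src D := by rwa [T.boxV.tgt_comp]
    simp [mulBox, dif_pos h₁, dif_neg h₂, mulMap_box, dif_neg h₃]
  · have h₃ : ¬ T.boxV.tgt A = T.boxV.src (T.boxV.comp C D h₂) := by rwa [T.boxV.src_comp]
    simp [mulBox, dif_pos h₂, dif_neg h₁, mulMap_box, dif_neg h₃]
  · simp [mulBox, dif_neg h₂, dif_neg h₁]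

theorem box_induction {p : BoxAlgebra T ϑ → Prop} (a : BoxAlgebra T ϑ) (zero : p 0)
    (add : ∀ x y, p x → p y → p (x + y)) (smul : ∀ (r : k) A, p (r • box T ϑ A)) : p a := by
  rw [← (basis T ϑ).linearCombination_repr a]
  induction (basis T ϑ).repr a using Finsupp.induction_linear with
  | zero => simpa using zero
  | add f g hf hg => simpa using add _ _ hf hg
  | single A r => simpa [box] using smul r A

theorem mulMap_assoc (a b c : BoxAlgebra T ϑ) :
    mulMap T ϑ (mulMap T ϑ a b) c = mulMap T ϑ a (mulMap T ϑ b c) := by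
  induction a using box_induction with
  | zero => simp
  | add x y hx hy => simp only [map_add, LinearMap.add_apply, hx, hy]
  | smul r A =>
    induction b using box_induction with
    | zero => simp
    | add x y hx hy => simp only [map_add, LinearMap.add_apply, hx, hy]
    | smul s C =>
      induction c using box_induction with
      | zero => simp
      | add x y hx hy => simp only [map_add, hx, hy]
      | smul u D => simp only [map_smul, LinearMap.smul_apply, mulMap_box_assoc]

noncomputable instance [Fintype H] : Ring (BoxAlgebra T ϑ) :=
  { (inferInstance : AddCommGroup (BoxAlgebra T ϑ)) with
    mul := fun a b => mulMap T ϑ a b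
    one := unitElt T ϑ
    left_distrib := fun a b c => map_add (mulMap T ϑ a) b c
    right_distrib := fun a b c => LinearMap.map_add₂ (mulMap T ϑ) a b c
    zero_mul := fun a => LinearMap.map_zero₂ (mulMap T ϑ) a
    mul_zero := fun a => map_zero (mulMap T ϑ a)
    mul_assoc := mulMap_assoc T ϑ
    one_mul := unitElt_mul T ϑ
    mul_one := mul_unitElt T ϑ }

noncomputable instance [Fintype H] : Algebra k (BoxAlgebra T ϑ) :=
  Algebra.ofModule (fun r a b => LinearMap.map_smul₂ (mulMap T ϑ) r a b)
    (fun r a b => map_smul (mulMap T ϑ a) r b)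

open Classical in
/-- The comultiplication `Δ(A) = ∑_{XY = A} ϑ(bl Y) X ⊗ Y`. -/
noncomputable def comulMap [Fintype B] :
    BoxAlgebra T ϑ →ₗ[k] BoxAlgebra T ϑ ⊗[k] BoxAlgebra T ϑ :=
  (basis T ϑ).constr k fun A => ∑ X : B, ∑ Y : B,
    (if T.HComp X Y A then (ϑ (T.bl Y) : k) else 0) • (box T ϑ X ⊗ₜ[k] box T ϑ Y)

open Classical in
/-- The counit: `ε(A) = 1 / ϑ(bl A)` if `A` is a horizontal identity, and `ε(A) = 0` otherwise. -/
noncomputable def counitMap : BoxAlgebra T ϑ →ₗ[k] k :=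
  (basis T ϑ).constr k fun A => if T.IsHorizontalIdentity A then (ϑ (T.bl A) : k)⁻¹ else 0

open Classical in
theorem comulMap_box [Fintype B] (A : B) : comulMap T ϑ (box T ϑ A) = ∑ X : B, ∑ Y : B,
    (if T.HComp X Y A then (ϑ (T.bl Y) : k) else 0) • (box T ϑ X ⊗ₜ[k] box T ϑ Y) := by
  rw [comulMap, box, Module.Basis.constr_basis]

open Classical in
theorem counitMap_box (A : B) : counitMap T ϑ (box T ϑ A) =
    if T.IsHorizontalIdentity A then (ϑ (T.bl A) : k)⁻¹ else 0 := by
  rw [counitMap, box, Module.Basis.constr_basis]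

theorem bl_one (g : V) : T.bl (T.boxH.one g) = T.ver.tgt g := by
  rw [bl, T.bottom_one, T.hor.src_one]

theorem bl_hcomp {X Y A : B} (h : T.HComp X Y A) : T.bl A = T.bl X := by
  obtain ⟨h, rfl⟩ := h
  rw [bl, bl, T.bottomLeft, T.bottomLeft, T.boxH.src_comp]

open Classical in
theorem coassoc_coeff [Fintype B] (A X Y Z : B) :
    ∑ W : B, (if T.HComp W Z A then (ϑ (T.bl Z) : k) else 0) *
        (if T.HComp X Y W then (ϑ (T.bl Y) : k) else 0) =
      ∑ W : B, (if T.HComp X W A then (ϑ (T.bl W) : k) else 0) *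
        (if T.HComp Y Z W then (ϑ (T.bl Z) : k) else 0) := by
  by_cases h₁ : T.boxH.tgt X = T.boxH.src Y <;> by_cases h₂ : T.boxH.tgt Y = T.boxH.src Z
  · have h₃ := (T.boxH.tgt_comp X Y h₁).trans h₂
    have h₄ := h₁.trans (T.boxH.src_comp Y Z h₂).symm
    have h₅ := T.boxH.assoc X Y Z h₁ h₂
    rw [Finset.sum_eq_single (T.boxH.comp X Y h₁), Finset.sum_eq_single (T.boxH.comp Y Z h₂)]
    · rw [if_pos (show T.HComp X Y _ from ⟨h₁, rfl⟩), if_pos (show T.HComp Y Z _ from ⟨h₂, rfl⟩),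
        bl_hcomp T (show T.HComp Y Z _ from ⟨h₂, rfl⟩)]
      have : T.HComp (T.boxH.comp X Y h₁) Z A ↔ T.HComp X (T.boxH.comp Y Z h₂) A := by
        constructor
        · rintro ⟨h, rfl⟩; exact ⟨h₄, h₅.symm⟩
        · rintro ⟨h, rfl⟩; exact ⟨h₃, h₅⟩
      simp only [this]
      split_ifs <;> ring
    · intro W _ hW
      rw [if_neg (c := T.HComp Y Z W), mul_zero]
      rintro ⟨_, rfl⟩; exact hW rfl
    · simp
    · intro W _ hW
      rw [if_neg (c := T.HComp X Y W), mul_zero]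
      rintro ⟨_, rfl⟩; exact hW rfl
    · simp
  all_goals
    rw [Finset.sum_eq_zero, Finset.sum_eq_zero]
    · intro W _
      by_cases h : T.HComp Y Z W
      · rw [if_neg (c := T.HComp X W A), zero_mul]
        obtain ⟨h, rfl⟩ := h
        rintro ⟨h', -⟩
        rw [T.boxH.src_comp] at h'
        first | exact h₁ h' | exact h₂ h
      · rw [if_neg h, mul_zero]
    · intro W _
      by_cases h : T.HComp X Y W
      · rw [if_neg (c := T.HComp W Z A), zero_mul]
        obtain ⟨h, rfl⟩ := h
        rintro ⟨h', -⟩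
        rw [T.boxH.tgt_comp] at h'
        first | exact h₂ h' | exact h₁ h
      · rw [if_neg h, mul_zero]

theorem hcomp_identity_left {g : V} {Y A : B} (h : T.HComp (T.boxH.one g) Y A) :
    g = T.boxH.src A ∧ Y = A := by
  obtain ⟨h, rfl⟩ := h
  have hg : g = T.boxH.src Y := by rw [← h, T.boxH.tgt_one]
  subst hg
  rw [T.boxH.one_comp]
  exact ⟨rfl, rfl⟩

theorem hcomp_identity_right {g : V} {X A : B} (h : T.HComp X (T.boxH.one g) A) :
    g = T.boxH.tgt A ∧ X = A := by
  obtain ⟨h, rfl⟩ := h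
  have hg : g = T.boxH.tgt X := by rw [h, T.boxH.src_one]
  subst hg
  rw [T.boxH.comp_one]
  exact ⟨rfl, rfl⟩

noncomputable instance [Fintype B] : Coalgebra k (BoxAlgebra T ϑ) where
  comul := comulMap T ϑ
  counit := counitMap T ϑ
  coassoc := by
    classical
    refine (basis T ϑ).ext fun A => ?_
    change TensorProduct.assoc k _ _ _ ((comulMap T ϑ).rTensor _ (comulMap T ϑ (box T ϑ A))) =
      (comulMap T ϑ).lTensor _ (comulMap T ϑ (box T ϑ A))
    simp only [comulMap_box, map_sum, map_smul, LinearMap.rTensor_tmul, LinearMap.lTensor_tmul,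
      TensorProduct.sum_tmul, TensorProduct.tmul_sum, ← TensorProduct.smul_tmul',
      TensorProduct.tmul_smul, TensorProduct.assoc_tmul, Finset.smul_sum, smul_smul]
    calc
      _ = ∑ X : B, ∑ Y : B, ∑ Z : B, ∑ W : B,
          ((if T.HComp W Z A then (ϑ (T.bl Z) : k) else 0) *
            (if T.HComp X Y W then (ϑ (T.bl Y) : k) else 0)) •
              (box T ϑ X ⊗ₜ[k] (box T ϑ Y ⊗ₜ[k] box T ϑ Z)) := by
        rw [Finset.sum_congr rfl fun W _ => Finset.sum_comm, Finset.sum_comm]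
        refine Finset.sum_congr rfl fun X _ => ?_
        rw [Finset.sum_congr rfl fun W _ => Finset.sum_comm, Finset.sum_comm]
        exact Finset.sum_congr rfl fun Y _ => Finset.sum_comm
      _ = ∑ X : B, ∑ Y : B, ∑ Z : B, ∑ W : B,
          ((if T.HComp X W A then (ϑ (T.bl W) : k) else 0) *
            (if T.HComp Y Z W then (ϑ (T.bl Z) : k) else 0)) •
              (box T ϑ X ⊗ₜ[k] (box T ϑ Y ⊗ₜ[k] box T ϑ Z)) := by
        simp only [← Finset.sum_smul, coassoc_coeff T ϑ A]
      _ = _ := by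
        refine Finset.sum_congr rfl fun X _ => ?_
        rw [Finset.sum_congr rfl fun Y _ => Finset.sum_comm]
        exact Finset.sum_comm
  rTensor_counit_comp_comul := by
    classical
    refine (basis T ϑ).ext fun A => ?_
    change (counitMap T ϑ).rTensor _ (comulMap T ϑ (box T ϑ A)) = 1 ⊗ₜ[k] box T ϑ A
    simp only [comulMap_box, map_sum, map_smul, LinearMap.rTensor_tmul]
    rw [Finset.sum_eq_single (T.boxH.one (T.boxH.src A)), Finset.sum_eq_single A]
    · have h : T.HComp (T.boxH.one (T.boxH.src A)) A A := ⟨T.boxH.tgt_one _, T.boxH.one_comp A⟩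
      rw [if_pos h, counitMap_box, if_pos ⟨_, rfl⟩, TensorProduct.smul_tmul', ← bl_hcomp T h,
        smul_eq_mul, mul_inv_cancel₀ (Units.ne_zero _)]
    · intro Y _ hY
      rw [if_neg, zero_smul]
      exact fun h => hY (hcomp_identity_left T h).2
    · simp
    · intro X _ hX
      refine Finset.sum_eq_zero fun Y _ => ?_
      by_cases hc : T.HComp X Y A
      · rw [counitMap_box, if_neg (c := T.IsHorizontalIdentity X), TensorProduct.zero_tmul, smul_zero]
        rintro ⟨g, rfl⟩
        exact hX (by rw [(hcomp_identity_left T hc).1])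
      · rw [if_neg hc, zero_smul]
    · simp
  lTensor_counit_comp_comul := by
    classical
    refine (basis T ϑ).ext fun A => ?_
    change (counitMap T ϑ).lTensor _ (comulMap T ϑ (box T ϑ A)) = box T ϑ A ⊗ₜ[k] 1
    simp only [comulMap_box, map_sum, map_smul, LinearMap.lTensor_tmul]
    rw [Finset.sum_eq_single A, Finset.sum_eq_single (T.boxH.one (T.boxH.tgt A))]
    · have h : T.HComp A (T.boxH.one (T.boxH.tgt A)) A :=
        ⟨(T.boxH.src_one _).symm, T.boxH.comp_one A⟩
      rw [if_pos h, counitMap_box, if_pos ⟨_, rfl⟩, ← TensorProduct.tmul_smul,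
        smul_eq_mul, mul_inv_cancel₀ (Units.ne_zero _)]
    · intro Y _ hY
      by_cases hc : T.HComp A Y A
      · rw [counitMap_box, if_neg (c := T.IsHorizontalIdentity Y), TensorProduct.tmul_zero, smul_zero]
        rintro ⟨g, rfl⟩
        exact hY (by rw [(hcomp_identity_right T hc).1])
      · rw [if_neg hc, zero_smul]
    · simp
    · intro X _ hX
      refine Finset.sum_eq_zero fun Y _ => ?_
      by_cases hc : T.HComp X Y A
      · rw [counitMap_box, if_neg (c := T.IsHorizontalIdentity Y), TensorProduct.tmul_zero, smul_zero]
        rintro ⟨g, rfl⟩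
        exact hX (hcomp_identity_right T hc).2
      · rw [if_neg hc, zero_smul]
    · simp

open Classical in
/-- The linear functional `φ` with `φ(A) = 1` if `A` is a vertical identity, and `φ(A) = 0`
for every other box `A`. -/
noncomputable def functional : BoxAlgebra T ϑ →ₗ[k] k :=
  (basis T ϑ).constr k fun A => if T.IsVerticalIdentity A then 1 else 0

end BoxAlgebra
end DoubleGroupoid

/-!
The proof is a calculation with boxes, made uniform by the following observations.

Write `A⁻¹` for the inverse of a box for both compositions at once.  In `Δ(A) = ∑ ϑ(bl Y) X ⊗ Y`
either factor determines the other: `Y` runs over the boxes with the right side of `A`, and `X` over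
those with the left side of `A` (`comul_box_right`, `comul_box_left`).  Hence
`Δ(1) = ∑ ϑ(br X) X ⊗ rightComplement X = ∑ ϑ(bl Z) leftComplement Z ⊗ Z`, where a complement is
the sum of all boxes that complete the given one to a vertical identity.

* `Δ` is multiplicative (`comul_box_mul_box`): by the interchange law, the pairs of horizontal
  factorizations of `A` and of `C` refine the factorizations of `A.C`, and the additional freedom
  is a box `Z` with prescribed top and right sides.  Normalization says that these boxes have total
  weight `1`.
* The unit axioms hold because the product of a right and a left complement, in either order, is the
  sum of the boxes `Y` with `X Y Z` a vertical identity (`rightComplement_mul_leftComplement`,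
  `leftComplement_mul_rightComplement`).
* The counit axioms hold because there is at most one factorization `D = X Y` with `A.X` and `Y.C`
  horizontal identities, and it exists exactly when `A.D.C` is one
  (`isHorizontalIdentity_split_left`, `isHorizontalIdentity_split_right`).
* The antipode is `S(A) = λ(A) A⁻¹`.  The products `X.Y⁻¹` and `X⁻¹.Y` that occur in `A₁ S(A₂)` and
  `S(A₁) A₂` depend on the factorization `A = X Y` only through a side (`mul_inv_eq`,
  `inv_mul_eq`), so that the weights of the factorizations with a given product add up to `1` by
  normalization at one of two opposite corners (`Normalized.sum_bl`, `Normalized.sum_tr`).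
* `λ` is a positive character for the vertical composition, so `A ↦ λ(A) A^v` extends to a
  conjugate-linear involution, and `φ(a^* b)` is the diagonal form with weights `λ(A) > 0` in the
  basis of boxes (`functional_star_mul`).  This gives the inner product, and left multiplication on
  the resulting Hilbert space is the faithful `*`-representation.

Compositions in a groupoid are replaced by a total operation `ArrowGroupoid.mul`, which makes
the calculations equational; composability survives only as side conditions.
-/

/-! ### Groupoids with a total composition -/

namespace ArrowGroupoid

variable {G P : Type*} (𝒢 : ArrowGroupoid G P)

open Classical in
/-- The composition extended to all pairs of arrows, with the junk value `f` when `f` and `g` are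
not composable.  Its source is then always the source of `f`. -/
noncomputable def mul (f g : G) : G := if h : 𝒢.tgt f = 𝒢.src g then 𝒢.comp f g h else f

variable {𝒢} {f g k : G}

theorem comp_eq_mul (h : 𝒢.tgt f = 𝒢.src g) : 𝒢.comp f g h = 𝒢.mul f g := by
  rw [mul, dif_pos h]

theorem src_mul : 𝒢.src (𝒢.mul f g) = 𝒢.src f := by
  unfold mul; split_ifs with h
  · exact 𝒢.src_comp f g h
  · rfl

theorem tgt_mul (h : 𝒢.tgt f = 𝒢.src g) : 𝒢.tgt (𝒢.mul f g) = 𝒢.tgt g := by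
  rw [← comp_eq_mul h, 𝒢.tgt_comp]

theorem mul_assoc (h₁ : 𝒢.tgt f = 𝒢.src g) (h₂ : 𝒢.tgt g = 𝒢.src k) :
    𝒢.mul (𝒢.mul f g) k = 𝒢.mul f (𝒢.mul g k) := by
  have := 𝒢.assoc f g k h₁ h₂
  simpa only [comp_eq_mul] using this

theorem one_mul {p : P} (h : p = 𝒢.src f) : 𝒢.mul (𝒢.one p) f = f := by
  subst h; rw [← comp_eq_mul (𝒢.tgt_one _), 𝒢.one_comp]

theorem mul_one {p : P} (h : p = 𝒢.tgt f) : 𝒢.mul f (𝒢.one p) = f := by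
  subst h; rw [← comp_eq_mul (𝒢.src_one _).symm, 𝒢.comp_one]

theorem inv_mul : 𝒢.mul (𝒢.inv f) f = 𝒢.one (𝒢.tgt f) := by
  rw [← comp_eq_mul (𝒢.tgt_inv _), 𝒢.inv_comp]

theorem mul_inv : 𝒢.mul f (𝒢.inv f) = 𝒢.one (𝒢.src f) := by
  rw [← comp_eq_mul (𝒢.src_inv _).symm, 𝒢.comp_inv]

theorem inv_mul_cancel_left (h : 𝒢.tgt f = 𝒢.src g) : 𝒢.mul (𝒢.inv f) (𝒢.mul f g) = g := by
  rw [← mul_assoc (𝒢.tgt_inv f) h, inv_mul, one_mul h]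

theorem mul_inv_cancel_left (h : 𝒢.src f = 𝒢.src g) : 𝒢.mul f (𝒢.mul (𝒢.inv f) g) = g := by
  rw [← mul_assoc (𝒢.src_inv f).symm (by rw [𝒢.tgt_inv, h]), mul_inv, one_mul h]

theorem mul_inv_cancel_right (h : 𝒢.tgt f = 𝒢.src g) : 𝒢.mul (𝒢.mul f g) (𝒢.inv g) = f := by
  rw [mul_assoc h (𝒢.src_inv g).symm, mul_inv, mul_one h.symm]

theorem inv_mul_cancel_right (h : 𝒢.tgt f = 𝒢.tgt g) : 𝒢.mul (𝒢.mul f (𝒢.inv g)) g = f := by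
  rw [mul_assoc (by rw [𝒢.src_inv, h]) (𝒢.tgt_inv g), inv_mul, mul_one h.symm]

theorem mul_left_cancel (h₁ : 𝒢.tgt f = 𝒢.src g) (h₂ : 𝒢.tgt f = 𝒢.src k)
    (h : 𝒢.mul f g = 𝒢.mul f k) : g = k := by
  rw [← inv_mul_cancel_left h₁, h, inv_mul_cancel_left h₂]

theorem mul_right_cancel (h₁ : 𝒢.tgt f = 𝒢.src k) (h₂ : 𝒢.tgt g = 𝒢.src k)
    (h : 𝒢.mul f k = 𝒢.mul g k) : f = g := by
  rw [← mul_inv_cancel_right h₁, h, mul_inv_cancel_right h₂]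

theorem eq_inv_of_mul_eq_one {p : P} (h : 𝒢.tgt f = 𝒢.src g) (hm : 𝒢.mul f g = 𝒢.one p) :
    g = 𝒢.inv f := by
  have hp : 𝒢.src f = p := by rw [← src_mul (g := g), hm, 𝒢.src_one]
  refine mul_left_cancel h (𝒢.src_inv f).symm ?_
  rw [hm, mul_inv, hp]

theorem inv_inv : 𝒢.inv (𝒢.inv f) = f :=
  (eq_inv_of_mul_eq_one (𝒢.tgt_inv f) inv_mul).symm

theorem inv_one {p : P} : 𝒢.inv (𝒢.one p) = 𝒢.one p :=
  (eq_inv_of_mul_eq_one (p := p) (by rw [𝒢.tgt_one, 𝒢.src_one])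
    (one_mul (by rw [𝒢.src_one]))).symm

theorem one_injective : Function.Injective 𝒢.one := fun p q h => by
  rw [← 𝒢.src_one p, h, 𝒢.src_one]

theorem inv_mul_rev (h : 𝒢.tgt f = 𝒢.src g) :
    𝒢.inv (𝒢.mul f g) = 𝒢.mul (𝒢.inv g) (𝒢.inv f) := by
  refine (eq_inv_of_mul_eq_one (p := 𝒢.src f) ?_ ?_).symm
  · rw [tgt_mul h, src_mul, 𝒢.src_inv]
  · rw [← mul_assoc (by rw [tgt_mul h, 𝒢.src_inv]) (by rw [𝒢.tgt_inv, 𝒢.src_inv, h]),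
      mul_inv_cancel_right h, mul_inv]

end ArrowGroupoid

/-! ### Sides and inverses of boxes -/

namespace DoubleGroupoid

open ArrowGroupoid

variable {P V H B : Type*} (T : DoubleGroupoid P V H B)

/-- The double groupoid with the horizontal and vertical directions exchanged. -/
def transpose : DoubleGroupoid P H V B where
  hor := T.ver
  ver := T.hor
  boxH := T.boxV
  boxV := T.boxH
  topLeft A := (T.topLeft A).symm
  topRight A := (T.bottomLeft A).symm
  bottomLeft A := (T.topRight A).symm
  bottomRight A := (T.bottomRight A).symm
  top_comp := T.left_comp
  bottom_comp := T.right_comp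
  top_one := T.left_one
  bottom_one := T.right_one
  left_comp := T.top_comp
  right_comp := T.bottom_comp
  left_one := T.top_one
  right_one := T.bottom_one
  one_comp_hor := T.one_comp_ver
  one_comp_ver := T.one_comp_hor
  one_one p := (T.one_one p).symm
  interchange A C D E h₁ h₂ h₃ h₄ h₅ h₆ := (T.interchange A D C E h₃ h₄ h₁ h₂ h₆ h₅).symm

variable {T} {A C D E : B}

theorem top_mul (h : T.boxH.tgt A = T.boxH.src C) :
    T.boxV.src (T.boxH.mul A C) = T.hor.mul (T.boxV.src A) (T.boxV.src C) := by
  have h' : T.hor.tgt (T.boxV.src A) = T.hor.src (T.boxV.src C) := by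
    rw [T.topRight, h, T.topLeft]
  rw [← comp_eq_mul h, T.top_comp A C h h', comp_eq_mul]

theorem bottom_mul (h : T.boxH.tgt A = T.boxH.src C) :
    T.boxV.tgt (T.boxH.mul A C) = T.hor.mul (T.boxV.tgt A) (T.boxV.tgt C) := by
  have h' : T.hor.tgt (T.boxV.tgt A) = T.hor.src (T.boxV.tgt C) := by
    rw [T.bottomRight, h, T.bottomLeft]
  rw [← comp_eq_mul h, T.bottom_comp A C h h', comp_eq_mul]

theorem left_mul (h : T.boxV.tgt A = T.boxV.src C) :
    T.boxH.src (T.boxV.mul A C) = T.ver.mul (T.boxH.src A) (T.boxH.src C) :=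
  top_mul (T := T.transpose) h

theorem right_mul (h : T.boxV.tgt A = T.boxV.src C) :
    T.boxH.tgt (T.boxV.mul A C) = T.ver.mul (T.boxH.tgt A) (T.boxH.tgt C) :=
  bottom_mul (T := T.transpose) h

theorem top_inv : T.boxV.src (T.boxH.inv A) = T.hor.inv (T.boxV.src A) := by
  refine eq_inv_of_mul_eq_one (p := T.ver.src (T.boxH.src A)) ?_ ?_
  · rw [T.topRight, T.topLeft, T.boxH.src_inv]
  · rw [← top_mul (T.boxH.src_inv A).symm, mul_inv, T.top_one]

theorem bottom_inv : T.boxV.tgt (T.boxH.inv A) = T.hor.inv (T.boxV.tgt A) := by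
  refine eq_inv_of_mul_eq_one (p := T.ver.tgt (T.boxH.src A)) ?_ ?_
  · rw [T.bottomRight, T.bottomLeft, T.boxH.src_inv]
  · rw [← bottom_mul (T.boxH.src_inv A).symm, mul_inv, T.bottom_one]

theorem left_inv : T.boxH.src (T.boxV.inv A) = T.ver.inv (T.boxH.src A) :=
  top_inv (T := T.transpose)

theorem right_inv : T.boxH.tgt (T.boxV.inv A) = T.ver.inv (T.boxH.tgt A) :=
  bottom_inv (T := T.transpose)

theorem interchange_mul (h₁ : T.boxH.tgt A = T.boxH.src C) (h₂ : T.boxH.tgt D = T.boxH.src E)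
    (h₃ : T.boxV.tgt A = T.boxV.src D) (h₄ : T.boxV.tgt C = T.boxV.src E) :
    T.boxV.mul (T.boxH.mul A C) (T.boxH.mul D E) =
      T.boxH.mul (T.boxV.mul A D) (T.boxV.mul C E) := by
  have h₅ : T.boxV.tgt (T.boxH.comp A C h₁) = T.boxV.src (T.boxH.comp D E h₂) := by
    rw [comp_eq_mul, comp_eq_mul, bottom_mul h₁, top_mul h₂, h₃, h₄]
  have h₆ : T.boxH.tgt (T.boxV.comp A D h₃) = T.boxH.src (T.boxV.comp C E h₄) := by
    rw [comp_eq_mul, comp_eq_mul, right_mul h₃, left_mul h₄, h₁, h₂]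
  simpa only [comp_eq_mul] using T.interchange A C D E h₁ h₂ h₃ h₄ h₅ h₆

theorem one_mul_hor {x y : H} (h : T.hor.tgt x = T.hor.src y) :
    T.boxV.one (T.hor.mul x y) = T.boxH.mul (T.boxV.one x) (T.boxV.one y) := by
  have h' : T.boxH.tgt (T.boxV.one x) = T.boxH.src (T.boxV.one y) := by
    rw [T.right_one, T.left_one, h]
  simpa only [comp_eq_mul] using T.one_comp_hor x y h h'

theorem one_inv_hor {x : H} : T.boxV.one (T.hor.inv x) = T.boxH.inv (T.boxV.one x) := by
  refine eq_inv_of_mul_eq_one (p := T.ver.one (T.hor.src x)) ?_ ?_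
  · rw [T.right_one, T.left_one, T.hor.src_inv]
  · rw [← one_mul_hor (T.hor.src_inv x).symm, mul_inv, T.one_one]

theorem one_mul_ver {f g : V} (h : T.ver.tgt f = T.ver.src g) :
    T.boxH.one (T.ver.mul f g) = T.boxV.mul (T.boxH.one f) (T.boxH.one g) :=
  one_mul_hor (T := T.transpose) h

theorem one_inv_ver {f : V} : T.boxH.one (T.ver.inv f) = T.boxV.inv (T.boxH.one f) :=
  one_inv_hor (T := T.transpose)

theorem horizontal_inv_mul (h : T.boxV.tgt A = T.boxV.src C) :
    T.boxH.inv (T.boxV.mul A C) = T.boxV.mul (T.boxH.inv A) (T.boxH.inv C) := by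
  have h' : T.boxV.tgt (T.boxH.inv A) = T.boxV.src (T.boxH.inv C) := by
    rw [bottom_inv, top_inv, h]
  refine (eq_inv_of_mul_eq_one (p := T.boxH.src (T.boxV.mul A C)) ?_ ?_).symm
  · rw [right_mul h, left_mul h', T.boxH.src_inv, T.boxH.src_inv]
  · rw [← interchange_mul (T.boxH.src_inv A).symm (T.boxH.src_inv C).symm h h', mul_inv, mul_inv,
      left_mul h, one_mul_ver]
    rw [← T.bottomLeft, h, T.topLeft]

theorem inv_comm : T.boxV.inv (T.boxH.inv A) = T.boxH.inv (T.boxV.inv A) := by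
  have h : T.boxV.tgt A = T.boxV.src (T.boxV.inv A) := (T.boxV.src_inv A).symm
  refine (eq_inv_of_mul_eq_one (p := T.hor.inv (T.boxV.src A)) ?_ ?_).symm
  · rw [bottom_inv, top_inv, h]
  · rw [← horizontal_inv_mul h, mul_inv, one_inv_hor]

theorem hComp_iff {X Y : B} :
    T.HComp X Y A ↔ T.boxH.tgt X = T.boxH.src Y ∧ T.boxH.mul X Y = A :=
  ⟨fun ⟨h, e⟩ => ⟨h, by rw [← comp_eq_mul h, e]⟩, fun ⟨h, e⟩ => ⟨h, by rw [comp_eq_mul, e]⟩⟩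

theorem hComp_iff_right {X Y : B} :
    T.HComp X Y A ↔ T.boxH.src X = T.boxH.src A ∧ Y = T.boxH.mul (T.boxH.inv X) A := by
  rw [hComp_iff]
  constructor
  · rintro ⟨h, rfl⟩
    exact ⟨src_mul.symm, (inv_mul_cancel_left h).symm⟩
  · rintro ⟨h, rfl⟩
    exact ⟨by rw [src_mul, T.boxH.src_inv], mul_inv_cancel_left h⟩

theorem hComp_iff_left {X Y : B} :
    T.HComp X Y A ↔ T.boxH.tgt Y = T.boxH.tgt A ∧ X = T.boxH.mul A (T.boxH.inv Y) := by
  rw [hComp_iff]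
  constructor
  · rintro ⟨h, rfl⟩
    exact ⟨(tgt_mul h).symm, (mul_inv_cancel_right h).symm⟩
  · rintro ⟨h, rfl⟩
    have h' : T.boxH.tgt A = T.boxH.src (T.boxH.inv Y) := by rw [T.boxH.src_inv, h]
    exact ⟨by rw [tgt_mul h', T.boxH.tgt_inv], inv_mul_cancel_right h.symm⟩

end DoubleGroupoid

/-! ### Normalization and the structure maps on boxes -/

attribute [grind _=_] DoubleGroupoid.topLeft DoubleGroupoid.topRight DoubleGroupoid.bottomLeft
  DoubleGroupoid.bottomRight

attribute [grind =] ArrowGroupoid.src_one ArrowGroupoid.tgt_one ArrowGroupoid.src_inv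
  ArrowGroupoid.tgt_inv ArrowGroupoid.src_mul ArrowGroupoid.tgt_mul ArrowGroupoid.inv_inv
  ArrowGroupoid.inv_one ArrowGroupoid.inv_mul ArrowGroupoid.mul_inv
  DoubleGroupoid.top_one DoubleGroupoid.bottom_one
  DoubleGroupoid.left_one DoubleGroupoid.right_one
  DoubleGroupoid.top_mul DoubleGroupoid.bottom_mul DoubleGroupoid.left_mul DoubleGroupoid.right_mul
  DoubleGroupoid.top_inv DoubleGroupoid.bottom_inv DoubleGroupoid.left_inv DoubleGroupoid.right_inv
  DoubleGroupoid.inv_comm DoubleGroupoid.one_one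

namespace DoubleGroupoid

open ArrowGroupoid

variable {P V H B : Type*} {T : DoubleGroupoid P V H B} {k : Type*} [Field k] {ϑ : P → kˣ}

open Classical in
theorem Normalized.sum_bl [Fintype B] (hn : T.Normalized ϑ) {g : V} {x : H}
    (h : T.ver.src g = T.hor.tgt x) :
    ∑ A : B with T.boxV.src A = x ∧ T.boxH.tgt A = g, (ϑ (T.bl A) : k) = 1 := by
  rw [Finset.sum_filter]
  exact hn g x h

open Classical in
/-- The normalization condition seen from the opposite corner: both inversions together exchange
the top and right sides with the bottom and left ones. -/
theorem Normalized.sum_tr [Fintype B] (hn : T.Normalized ϑ) {g : V} {x : H}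
    (h : T.ver.tgt g = T.hor.src x) :
    ∑ A : B with T.boxH.src A = g ∧ T.boxV.tgt A = x, (ϑ (T.tr A) : k) = 1 := by
  have h' : T.ver.src (T.ver.inv g) = T.hor.tgt (T.hor.inv x) := by
    rw [T.ver.src_inv, T.hor.tgt_inv, h]
  rw [← hn.sum_bl h']
  refine Finset.sum_nbij' (fun A => T.boxV.inv (T.boxH.inv A))
    (fun A => T.boxV.inv (T.boxH.inv A)) ?_ ?_ ?_ ?_ ?_
  · simp only [Finset.mem_filter, Finset.mem_univ, true_and]; grind
  · simp only [Finset.mem_filter, Finset.mem_univ, true_and]; grind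
  · intros; grind
  · intros; grind
  · intros; congr 2; simp only [tr, bl]; grind

namespace BoxAlgebra

section Mul

variable [Fintype H]

open Classical in
theorem box_mul_box (A C : B) : box T ϑ A * box T ϑ C =
    if T.boxV.tgt A = T.boxV.src C then box T ϑ (T.boxV.mul A C) else 0 := by
  change mulMap T ϑ (box T ϑ A) (box T ϑ C) = _
  rw [mulMap_box, mulBox]
  split_ifs with h
  · rw [comp_eq_mul]
  · rfl

theorem box_mul_box_of_eq {A C : B} (h : T.boxV.tgt A = T.boxV.src C) :
    box T ϑ A * box T ϑ C = box T ϑ (T.boxV.mul A C) := by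
  rw [box_mul_box, if_pos h]

theorem box_mul_box_of_ne {A C : B} (h : T.boxV.tgt A ≠ T.boxV.src C) :
    box T ϑ A * box T ϑ C = 0 := by
  rw [box_mul_box, if_neg h]

theorem one_eq_sum : (1 : BoxAlgebra T ϑ) = ∑ x : H, box T ϑ (T.boxV.one x) := rfl

end Mul

theorem bl_inv_mul {X A : B} (h : T.boxH.src X = T.boxH.src A) :
    T.bl (T.boxH.mul (T.boxH.inv X) A) = T.br X := by
  rw [bl, bottom_mul (by rw [T.boxH.tgt_inv, h]), src_mul, bottom_inv, T.hor.src_inv, br]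

variable [Fintype B]

open Classical in
/-- The comultiplication as a sum over the left factors. -/
theorem comul_box_left (A : B) : Coalgebra.comul (R := k) (box T ϑ A) =
    ∑ X : B with T.boxH.src X = T.boxH.src A,
      (ϑ (T.br X) : k) • (box T ϑ X ⊗ₜ[k] box T ϑ (T.boxH.mul (T.boxH.inv X) A)) := by
  change comulMap T ϑ (box T ϑ A) = _
  rw [comulMap_box, Finset.sum_filter]
  refine Finset.sum_congr rfl fun X _ => ?_
  split_ifs with h
  · rw [Finset.sum_eq_single (T.boxH.mul (T.boxH.inv X) A),
      if_pos (hComp_iff_right.2 ⟨h, rfl⟩), bl_inv_mul h]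
    · intro Y _ hY
      rw [if_neg fun hc => hY (hComp_iff_right.1 hc).2, zero_smul]
    · simp
  · refine Finset.sum_eq_zero fun Y _ => ?_
    rw [if_neg fun hc => h (hComp_iff_right.1 hc).1, zero_smul]

open Classical in
/-- The comultiplication as a sum over the right factors. -/
theorem comul_box_right (A : B) : Coalgebra.comul (R := k) (box T ϑ A) =
    ∑ Y : B with T.boxH.tgt Y = T.boxH.tgt A,
      (ϑ (T.bl Y) : k) • (box T ϑ (T.boxH.mul A (T.boxH.inv Y)) ⊗ₜ[k] box T ϑ Y) := by
  change comulMap T ϑ (box T ϑ A) = _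
  rw [comulMap_box, Finset.sum_filter, Finset.sum_comm]
  refine Finset.sum_congr rfl fun Y _ => ?_
  split_ifs with h
  · rw [Finset.sum_eq_single (T.boxH.mul A (T.boxH.inv Y)),
      if_pos (hComp_iff_left.2 ⟨h, rfl⟩)]
    · intro X _ hX
      rw [if_neg fun hc => hX (hComp_iff_left.1 hc).2, zero_smul]
    · simp
  · refine Finset.sum_eq_zero fun X _ => ?_
    rw [if_neg fun hc => h (hComp_iff_left.1 hc).1, zero_smul]

end BoxAlgebra
end DoubleGroupoid

/-! ### Multiplicativity of the comultiplication -/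

namespace DoubleGroupoid

open ArrowGroupoid

variable {P V H B : Type*} {T : DoubleGroupoid P V H B} {k : Type*} [Field k] {ϑ : P → kˣ}

namespace BoxAlgebra

variable [Fintype B] [Fintype H]

open Classical in
theorem comul_box_mul_box (hn : T.Normalized ϑ) (A C : B) :
    Coalgebra.comul (R := k) (box T ϑ A * box T ϑ C) =
      Coalgebra.comul (R := k) (box T ϑ A) * Coalgebra.comul (R := k) (box T ϑ C) := by
  rw [comul_box_right A, comul_box_right C, Finset.sum_mul_sum]
  simp only [smul_mul_smul_comm, Algebra.TensorProduct.tmul_mul_tmul]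
  by_cases h : T.boxV.tgt A = T.boxV.src C
  · rw [box_mul_box_of_eq h, comul_box_right]
    -- The box `Z` is the upper part of the right factor `Y = Z.Y'` of `A.C`; its weights add up to
    -- `1`, so the sum over `Z` may be inserted.
    calc
      _ = ∑ Y : B with T.boxH.tgt Y = T.boxH.tgt (T.boxV.mul A C),
          ∑ Z : B with T.boxV.src Z = T.boxV.src Y ∧ T.boxH.tgt Z = T.boxH.tgt A,
            (ϑ (T.bl Z) * ϑ (T.bl Y) : k) •
              (box T ϑ (T.boxH.mul (T.boxV.mul A C) (T.boxH.inv Y)) ⊗ₜ[k] box T ϑ Y) := by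
        refine Finset.sum_congr rfl fun Y hY => ?_
        simp only [Finset.mem_filter, Finset.mem_univ, true_and] at hY
        rw [← Finset.sum_smul, ← Finset.sum_mul, hn.sum_bl, _root_.one_mul]
        grind
      _ = ∑ Z : B with T.boxH.tgt Z = T.boxH.tgt A,
          ∑ Y : B with T.boxH.tgt Y = T.boxH.tgt (T.boxV.mul A C) ∧ T.boxV.src Z = T.boxV.src Y,
            (ϑ (T.bl Z) * ϑ (T.bl Y) : k) •
              (box T ϑ (T.boxH.mul (T.boxV.mul A C) (T.boxH.inv Y)) ⊗ₜ[k] box T ϑ Y) := by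
        refine Finset.sum_comm' fun Y Z => ?_
        simp only [Finset.mem_filter, Finset.mem_univ, true_and]
        tauto
      _ = _ := by
        refine Finset.sum_congr rfl fun Z hZ => ?_
        simp only [Finset.mem_filter, Finset.mem_univ, true_and] at hZ
        rw [← Finset.sum_filter_of_ne (s := Finset.univ.filter fun Y => T.boxH.tgt Y = T.boxH.tgt C)
          (p := fun Y => T.boxV.tgt Z = T.boxV.src Y)]
        · rw [Finset.filter_filter]
          -- For fixed `Z`, the boxes `Y` correspond to the lower parts `Y' = Z^v.Y`.
          refine Finset.sum_nbij' (fun Y => T.boxV.mul (T.boxV.inv Z) Y)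
            (fun Y => T.boxV.mul Z Y) ?_ ?_ ?_ ?_ ?_
          · simp only [Finset.mem_filter, Finset.mem_univ, true_and]
            rintro Y ⟨h₁, h₂⟩
            refine ⟨?_, ?_⟩
            · rw [right_mul (by grind), right_inv, h₁, right_mul h, hZ,
                ArrowGroupoid.inv_mul_cancel_left (by grind)]
            · grind
          · simp only [Finset.mem_filter, Finset.mem_univ, true_and]
            rintro Y ⟨h₁, h₂⟩
            refine ⟨?_, ?_⟩
            · rw [right_mul h₂, right_mul h, h₁, hZ]
            · grind
          · simp only [Finset.mem_filter, Finset.mem_univ, true_and]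
            rintro Y ⟨h₁, h₂⟩
            exact mul_inv_cancel_left h₂
          · simp only [Finset.mem_filter, Finset.mem_univ, true_and]
            rintro Y ⟨h₁, h₂⟩
            exact inv_mul_cancel_left h₂
          · simp only [Finset.mem_filter, Finset.mem_univ, true_and]
            rintro Y ⟨h₁, h₂⟩
            have h₃ : T.boxV.tgt Z = T.boxV.src (T.boxV.mul (T.boxV.inv Z) Y) := by grind
            have h₄ : T.boxH.tgt (T.boxV.mul (T.boxV.inv Z) Y) = T.boxH.tgt C := by
              rw [right_mul (by grind), right_inv, h₁, right_mul h, hZ,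
                ArrowGroupoid.inv_mul_cancel_left (by grind)]
            have h₅ : T.boxV.mul Z (T.boxV.mul (T.boxV.inv Z) Y) = Y := mul_inv_cancel_left h₂
            have h₆ : T.boxV.tgt (T.boxH.mul A (T.boxH.inv Z)) =
                T.boxV.src (T.boxH.mul C (T.boxH.inv (T.boxV.mul (T.boxV.inv Z) Y))) := by
              grind
            rw [box_mul_box_of_eq h₃, box_mul_box_of_eq h₆,
              interchange_mul (by grind) (by grind) h (by grind), ← horizontal_inv_mul h₃, h₅]
            congr 3
            simp only [bl]; grind
        · intro Y _ hY
          by_contra h'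
          exact hY (by rw [box_mul_box_of_ne (T := T) (A := Z) h', TensorProduct.tmul_zero,
            smul_zero])
  · rw [box_mul_box_of_ne h, map_zero]
    refine (Finset.sum_eq_zero fun Z hZ => Finset.sum_eq_zero fun Y hY => ?_).symm
    simp only [Finset.mem_filter, Finset.mem_univ, true_and] at hZ hY
    by_cases h' : T.boxV.tgt Z = T.boxV.src Y
    · rw [box_mul_box_of_ne (A := T.boxH.mul A _), TensorProduct.zero_tmul, smul_zero]
      intro h₁
      rw [bottom_mul (by grind), top_mul (by grind), bottom_inv, top_inv, h'] at h₁
      exact h (mul_right_cancel (by grind) (by grind) h₁)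
    · rw [box_mul_box_of_ne h', TensorProduct.tmul_zero, smul_zero]

theorem comul_mul (hn : T.Normalized ϑ) (a b : BoxAlgebra T ϑ) :
    Coalgebra.comul (R := k) (a * b) = Coalgebra.comul (R := k) a * Coalgebra.comul (R := k) b := by
  induction a using box_induction with
  | zero => simp
  | add x y hx hy => simp only [add_mul, map_add, hx, hy]
  | smul r A =>
    induction b using box_induction with
    | zero => simp
    | add x y hx hy => simp only [mul_add, map_add, hx, hy]
    | smul s C =>
      simp only [smul_mul_smul_comm, map_smul, comul_box_mul_box hn]

end BoxAlgebra
end DoubleGroupoid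

/-! ### The comultiplication of the unit -/

section TensorProduct

variable {k R ι κ : Type*} [CommRing k] [Ring R] [Algebra k R] [Fintype ι] [Fintype κ]
  (c : ι → k) (a b : ι → R) (d : κ → k) (e f : κ → R)

theorem TensorProduct.assoc_sum_tmul_one_mul :
    TensorProduct.assoc k R R R ((∑ x, c x • (a x ⊗ₜ[k] b x)) ⊗ₜ[k] 1) *
      (1 ⊗ₜ[k] ∑ z, d z • (e z ⊗ₜ[k] f z)) =
    ∑ x, ∑ z, (c x * d z) • (a x ⊗ₜ[k] ((b x * e z) ⊗ₜ[k] f z)) := by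
  simp only [TensorProduct.sum_tmul, TensorProduct.tmul_sum, ← TensorProduct.smul_tmul',
    TensorProduct.tmul_smul, map_sum, map_smul, TensorProduct.assoc_tmul, Finset.sum_mul_sum,
    smul_mul_smul_comm, Algebra.TensorProduct.tmul_mul_tmul, mul_one, one_mul]

theorem TensorProduct.one_tmul_sum_mul_assoc :
    (1 ⊗ₜ[k] ∑ z, d z • (e z ⊗ₜ[k] f z)) *
      TensorProduct.assoc k R R R ((∑ x, c x • (a x ⊗ₜ[k] b x)) ⊗ₜ[k] 1) =
    ∑ x, ∑ z, (c x * d z) • (a x ⊗ₜ[k] ((e z * b x) ⊗ₜ[k] f z)) := by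
  rw [Finset.sum_comm]
  simp only [TensorProduct.sum_tmul, TensorProduct.tmul_sum, ← TensorProduct.smul_tmul',
    TensorProduct.tmul_smul, map_sum, map_smul, TensorProduct.assoc_tmul, Finset.sum_mul_sum,
    smul_mul_smul_comm, Algebra.TensorProduct.tmul_mul_tmul, mul_one, one_mul, mul_comm (d _)]

end TensorProduct

namespace DoubleGroupoid

open ArrowGroupoid

variable {P V H B : Type*} {T : DoubleGroupoid P V H B} {k : Type*} [Field k] {ϑ : P → kˣ}

namespace BoxAlgebra

variable [Fintype H]

variable (T ϑ) in
open Classical in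
/-- The sum of all boxes `Y` for which `X Y` is defined and is a vertical identity; up to a scalar,
the right leg of `Δ(1)` that belongs to the left leg `X`. -/
noncomputable def rightComplement (X : B) : BoxAlgebra T ϑ :=
  ∑ x : H with T.boxH.src X = T.ver.one (T.hor.src x),
    box T ϑ (T.boxH.mul (T.boxH.inv X) (T.boxV.one x))

variable (T ϑ) in
open Classical in
/-- The sum of all boxes `Y` for which `Y Z` is defined and is a vertical identity; up to a scalar,
the left leg of `Δ(1)` that belongs to the right leg `Z`. -/
noncomputable def leftComplement (Z : B) : BoxAlgebra T ϑ :=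
  ∑ y : H with T.boxH.tgt Z = T.ver.one (T.hor.tgt y),
    box T ϑ (T.boxH.mul (T.boxV.one y) (T.boxH.inv Z))

variable (T ϑ) in
open Classical in
/-- The sum of all boxes `Y` for which `X Y Z` is defined and is a vertical identity. -/
noncomputable def middleComplement (X Z : B) : BoxAlgebra T ϑ :=
  ∑ w : H with T.boxH.src X = T.ver.one (T.hor.src w) ∧ T.boxH.tgt Z = T.ver.one (T.hor.tgt w),
    box T ϑ (T.boxH.mul (T.boxH.mul (T.boxH.inv X) (T.boxV.one w)) (T.boxH.inv Z))

/-- The product of the boxes completing `X` to `x` and `Z` to `y` is nonzero only if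
`x t(Z) = b(X) y`; it then completes `X`, `Z` to `x t(Z)`. -/
theorem rightComplement_mul_leftComplement (X Z : B) :
    rightComplement T ϑ X * leftComplement T ϑ Z = middleComplement T ϑ X Z := by
  classical
  rw [rightComplement, leftComplement, middleComplement, Finset.sum_mul_sum, ← Finset.sum_product']
  simp only [box_mul_box]
  rw [← Finset.sum_filter]
  refine Finset.sum_nbij' (fun p => T.hor.mul p.1 (T.boxV.src Z))
    (fun w => (T.hor.mul w (T.hor.inv (T.boxV.src Z)),
      T.hor.mul (T.hor.inv (T.boxV.tgt X)) w)) ?_ ?_ ?_ ?_ ?_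
  all_goals simp only [Finset.mem_filter, Finset.mem_univ, true_and, Finset.mem_product,
    Prod.forall, Prod.mk.injEq, and_imp]
  · intro x y hx hy h
    have hxZ : T.hor.tgt x = T.hor.src (T.boxV.src Z) := by
      have h₁ := congrArg T.hor.tgt h
      rw [bottom_mul (by grind), top_mul (by grind)] at h₁
      grind
    grind
  · intro w hX hZ
    have h₁ : T.hor.src (T.boxV.tgt X) = T.hor.src w := by grind
    have h₂ : T.hor.tgt w = T.hor.tgt (T.boxV.src Z) := by grind
    refine ⟨⟨by grind, by grind⟩, ?_⟩
    rw [bottom_mul (by grind), top_mul (by grind)]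
    grind [ArrowGroupoid.mul_assoc]
  · intro x y hx hy h
    have hxZ : T.hor.tgt x = T.hor.src (T.boxV.src Z) := by
      have h₁ := congrArg T.hor.tgt h
      rw [bottom_mul (by grind), top_mul (by grind)] at h₁
      grind
    refine ⟨ArrowGroupoid.mul_inv_cancel_right hxZ, ?_⟩
    rw [bottom_mul (by grind), top_mul (by grind), bottom_inv, top_inv, T.boxV.src_one,
      T.boxV.tgt_one] at h
    rw [← ArrowGroupoid.mul_assoc (by grind) (by grind), h,
      ArrowGroupoid.inv_mul_cancel_right (by grind)]
  · intro w hX hZ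
    exact ArrowGroupoid.inv_mul_cancel_right (by grind)
  · intro x y hx hy h
    have hxZ : T.hor.tgt x = T.hor.src (T.boxV.src Z) := by
      have h₁ := congrArg T.hor.tgt h
      rw [bottom_mul (by grind), top_mul (by grind)] at h₁
      grind
    rw [bottom_mul (by grind), top_mul (by grind), bottom_inv, top_inv, T.boxV.src_one,
      T.boxV.tgt_one] at h
    have hy' : y = T.hor.mul (T.hor.inv (T.boxV.tgt X)) (T.hor.mul x (T.boxV.src Z)) := by
      rw [← ArrowGroupoid.mul_assoc (by grind) (by grind), h,
        ArrowGroupoid.inv_mul_cancel_right (by grind)]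
    congr 1
    rw [hy', one_mul_hor (by grind), ArrowGroupoid.mul_assoc (by grind) (by grind),
      interchange_mul (by grind) (by grind) (by grind) ?_,
      ArrowGroupoid.mul_assoc (by grind) (by grind), ArrowGroupoid.mul_one (by grind),
      ArrowGroupoid.one_mul ?_]
    all_goals
      rw [top_mul (by grind), T.boxV.src_one, top_inv,
        ArrowGroupoid.mul_inv_cancel_right (by grind)]
    rw [T.boxV.tgt_one]

/-- The product of the boxes completing `Z` to `y` and `X` to `x` is nonzero only if
`x b(Z) = t(X) y`; it then completes `X`, `Z` to `x b(Z)`. -/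
theorem leftComplement_mul_rightComplement (X Z : B) :
    leftComplement T ϑ Z * rightComplement T ϑ X = middleComplement T ϑ X Z := by
  classical
  rw [rightComplement, leftComplement, middleComplement, Finset.sum_mul_sum, ← Finset.sum_product']
  simp only [box_mul_box]
  rw [← Finset.sum_filter]
  refine Finset.sum_nbij' (fun p => T.hor.mul p.2 (T.boxV.tgt Z))
    (fun w => (T.hor.mul (T.hor.inv (T.boxV.src X)) w,
      T.hor.mul w (T.hor.inv (T.boxV.tgt Z)))) ?_ ?_ ?_ ?_ ?_
  all_goals simp only [Finset.mem_filter, Finset.mem_univ, true_and, Finset.mem_product,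
    Prod.forall, Prod.mk.injEq, and_imp]
  · intro y x hy hx h
    have hxZ : T.hor.tgt x = T.hor.src (T.boxV.tgt Z) := by
      have h₁ := congrArg T.hor.tgt h
      rw [bottom_mul (by grind), top_mul (by grind)] at h₁
      grind
    grind
  · intro w hX hZ
    have h₁ : T.hor.src (T.boxV.tgt X) = T.hor.src w := by grind
    have h₂ : T.hor.tgt w = T.hor.tgt (T.boxV.src Z) := by grind
    refine ⟨⟨by grind, by grind⟩, ?_⟩
    rw [bottom_mul (by grind), top_mul (by grind)]
    grind [ArrowGroupoid.mul_assoc]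
  · intro y x hy hx h
    have hxZ : T.hor.tgt x = T.hor.src (T.boxV.tgt Z) := by
      have h₁ := congrArg T.hor.tgt h
      rw [bottom_mul (by grind), top_mul (by grind)] at h₁
      grind
    refine ⟨?_, ArrowGroupoid.mul_inv_cancel_right hxZ⟩
    rw [bottom_mul (by grind), top_mul (by grind), bottom_inv, top_inv, T.boxV.src_one,
      T.boxV.tgt_one] at h
    rw [← ArrowGroupoid.mul_assoc (by grind) (by grind), ← h,
      ArrowGroupoid.inv_mul_cancel_right (by grind)]
  · intro w hX hZ
    exact ArrowGroupoid.inv_mul_cancel_right (by grind)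
  · intro y x hy hx h
    have hxZ : T.hor.tgt x = T.hor.src (T.boxV.tgt Z) := by
      have h₁ := congrArg T.hor.tgt h
      rw [bottom_mul (by grind), top_mul (by grind)] at h₁
      grind
    rw [bottom_mul (by grind), top_mul (by grind), bottom_inv, top_inv, T.boxV.src_one,
      T.boxV.tgt_one] at h
    have hy' : y = T.hor.mul (T.hor.inv (T.boxV.src X)) (T.hor.mul x (T.boxV.tgt Z)) := by
      rw [← ArrowGroupoid.mul_assoc (by grind) (by grind), ← h,
        ArrowGroupoid.inv_mul_cancel_right (by grind)]
    congr 1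
    rw [hy', one_mul_hor (by grind), ArrowGroupoid.mul_assoc (by grind) (by grind),
      interchange_mul (by grind) (by grind) (by grind) ?_,
      ArrowGroupoid.mul_assoc (by grind) (by grind), ArrowGroupoid.one_mul (by grind),
      ArrowGroupoid.mul_one ?_]
    all_goals
      rw [bottom_mul (by grind), T.boxV.tgt_one, bottom_inv,
        ArrowGroupoid.mul_inv_cancel_right (by grind)]
    rw [T.boxV.src_one]

variable [Fintype B]

theorem comul_one_eq_sum_left : Coalgebra.comul (R := k) (1 : BoxAlgebra T ϑ) =
    ∑ X : B, (ϑ (T.br X) : k) • (box T ϑ X ⊗ₜ[k] rightComplement T ϑ X) := by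
  classical
  rw [one_eq_sum, map_sum]
  simp only [comul_box_left, T.left_one]
  rw [Finset.sum_comm' (t' := Finset.univ)
    (s' := fun X => Finset.univ.filter fun w => T.boxH.src X = T.ver.one (T.hor.src w))
    (by simp)]
  simp only [rightComplement, TensorProduct.tmul_sum, Finset.smul_sum]

theorem comul_one_eq_sum_right : Coalgebra.comul (R := k) (1 : BoxAlgebra T ϑ) =
    ∑ Z : B, (ϑ (T.bl Z) : k) • (leftComplement T ϑ Z ⊗ₜ[k] box T ϑ Z) := by
  classical
  rw [one_eq_sum, map_sum]
  simp only [comul_box_right, T.right_one]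
  rw [Finset.sum_comm' (t' := Finset.univ)
    (s' := fun Y => Finset.univ.filter fun w => T.boxH.tgt Y = T.ver.one (T.hor.tgt w))
    (by simp)]
  simp only [leftComplement, TensorProduct.sum_tmul, Finset.smul_sum]

theorem lTensor_comul_comul_one :
    (Coalgebra.comul (R := k)).lTensor _ (Coalgebra.comul (R := k) (1 : BoxAlgebra T ϑ)) =
      ∑ X : B, ∑ Z : B, (ϑ (T.br X) * ϑ (T.bl Z) : k) •
        (box T ϑ X ⊗ₜ[k] (middleComplement T ϑ X Z ⊗ₜ[k] box T ϑ Z)) := by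
  classical
  simp only [comul_one_eq_sum_left, rightComplement, middleComplement, map_sum, map_smul,
    LinearMap.lTensor_tmul, comul_box_right, TensorProduct.tmul_sum,
    TensorProduct.sum_tmul, TensorProduct.tmul_smul, Finset.smul_sum, smul_smul]
  refine Finset.sum_congr rfl fun X _ => Finset.sum_comm' fun w Z => ?_
  simp only [Finset.mem_filter, Finset.mem_univ, true_and, and_true, and_congr_right_iff]
  intro h
  rw [tgt_mul (by grind), T.right_one]

theorem comul_one : (Coalgebra.comul (R := k)).lTensor _
      (Coalgebra.comul (R := k) (1 : BoxAlgebra T ϑ)) =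
    TensorProduct.assoc k _ _ _ (Coalgebra.comul (R := k) (1 : BoxAlgebra T ϑ) ⊗ₜ[k] 1) *
      (1 ⊗ₜ[k] Coalgebra.comul (R := k) (1 : BoxAlgebra T ϑ)) := by
  rw [lTensor_comul_comul_one]
  conv_rhs => enter [1]; rw [comul_one_eq_sum_left]
  rw [comul_one_eq_sum_right]
  refine Eq.trans ?_ (TensorProduct.assoc_sum_tmul_one_mul _ _ _ _ _ _).symm
  simp only [rightComplement_mul_leftComplement]

theorem comul_one' : (Coalgebra.comul (R := k)).lTensor _
      (Coalgebra.comul (R := k) (1 : BoxAlgebra T ϑ)) =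
    (1 ⊗ₜ[k] Coalgebra.comul (R := k) (1 : BoxAlgebra T ϑ)) *
      TensorProduct.assoc k _ _ _ (Coalgebra.comul (R := k) (1 : BoxAlgebra T ϑ) ⊗ₜ[k] 1) := by
  rw [lTensor_comul_comul_one]
  conv_rhs => enter [2]; rw [comul_one_eq_sum_left]
  rw [comul_one_eq_sum_right]
  refine Eq.trans ?_ (TensorProduct.one_tmul_sum_mul_assoc _ _ _ _ _ _).symm
  simp only [leftComplement_mul_rightComplement]

end BoxAlgebra
end DoubleGroupoid

/-! ### Weak multiplicativity of the counit -/

section Multiplication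

variable {k R : Type*} [CommRing k] [Ring R] [Algebra k R] (c : k) (a b : R)

theorem LinearMap.mulLeft_add :
    LinearMap.mulLeft k (a + b) = LinearMap.mulLeft k a + LinearMap.mulLeft k b :=
  map_add (LinearMap.mul k R) a b

theorem LinearMap.mulLeft_smul : LinearMap.mulLeft k (c • a) = c • LinearMap.mulLeft k a :=
  map_smul (LinearMap.mul k R) c a

theorem LinearMap.mulRight_add :
    LinearMap.mulRight k (a + b) = LinearMap.mulRight k a + LinearMap.mulRight k b :=
  map_add (LinearMap.mul k R).flip a b

theorem LinearMap.mulRight_smul : LinearMap.mulRight k (c • a) = c • LinearMap.mulRight k a :=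
  map_smul (LinearMap.mul k R).flip c a

end Multiplication

namespace DoubleGroupoid

open ArrowGroupoid

variable {P V H B : Type*} {T : DoubleGroupoid P V H B} {k : Type*} [Field k] {ϑ : P → kˣ}
  {A C D X Y Z : B}

theorem isHorizontalIdentity_one (f : V) : T.IsHorizontalIdentity (T.boxH.one f) := ⟨f, rfl⟩

namespace IsHorizontalIdentity

theorem eq_one (h : T.IsHorizontalIdentity A) : A = T.boxH.one (T.boxH.src A) := by
  obtain ⟨f, rfl⟩ := h
  rw [T.boxH.src_one]

theorem top (h : T.IsHorizontalIdentity A) :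
    T.boxV.src A = T.hor.one (T.ver.src (T.boxH.src A)) := by
  obtain ⟨f, rfl⟩ := h; grind

theorem bottom (h : T.IsHorizontalIdentity A) :
    T.boxV.tgt A = T.hor.one (T.ver.tgt (T.boxH.src A)) := by
  obtain ⟨f, rfl⟩ := h; grind

theorem right (h : T.IsHorizontalIdentity A) : T.boxH.tgt A = T.boxH.src A := by
  obtain ⟨f, rfl⟩ := h; grind

theorem mul (hA : T.IsHorizontalIdentity A) (hC : T.IsHorizontalIdentity C)
    (h : T.boxV.tgt A = T.boxV.src C) : T.IsHorizontalIdentity (T.boxV.mul A C) := by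
  obtain ⟨f, rfl⟩ := hA
  obtain ⟨g, rfl⟩ := hC
  refine ⟨T.ver.mul f g, (one_mul_ver ?_).symm⟩
  rw [T.bottom_one, T.top_one] at h
  exact one_injective h

theorem inv (hA : T.IsHorizontalIdentity A) : T.IsHorizontalIdentity (T.boxV.inv A) := by
  obtain ⟨f, rfl⟩ := hA
  exact ⟨_, one_inv_ver.symm⟩

theorem mul_iff_right (hA : T.IsHorizontalIdentity A) (h : T.boxV.tgt A = T.boxV.src C) :
    T.IsHorizontalIdentity (T.boxV.mul A C) ↔ T.IsHorizontalIdentity C := by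
  refine ⟨fun hm => ?_, fun hC => hA.mul hC h⟩
  rw [← ArrowGroupoid.inv_mul_cancel_left h]
  exact hA.inv.mul hm (by grind)

end IsHorizontalIdentity

/-- If `A.X` is a horizontal identity, then splitting off `X` on the left of `D` replaces `A` by a
horizontal identity. -/
theorem mul_eq_of_isHorizontalIdentity_left (h₁ : T.boxV.tgt A = T.boxV.src X)
    (h₂ : T.boxH.src X = T.boxH.src D) (h₃ : T.boxV.src D = T.boxV.src X)
    (hid : T.IsHorizontalIdentity (T.boxV.mul A X)) :
    T.boxV.mul A D = T.boxV.mul (T.boxH.one (T.boxH.tgt A)) (T.boxH.mul (T.boxH.inv X) D) := by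
  have h₄ : T.boxV.tgt (T.boxH.one (T.boxH.tgt A)) =
      T.boxV.src (T.boxH.mul (T.boxH.inv X) D) := by
    rw [top_mul (by grind), h₃, top_inv, inv_mul]
    grind
  have h := interchange_mul (A := A) (C := T.boxH.one (T.boxH.tgt A)) (D := X)
    (E := T.boxH.mul (T.boxH.inv X) D) (by grind) (by grind) h₁ h₄
  rw [ArrowGroupoid.mul_one rfl, ArrowGroupoid.mul_inv_cancel_left h₂] at h
  rw [h, hid.eq_one, ArrowGroupoid.one_mul]
  rw [left_mul h₁, left_mul h₄, T.boxH.src_one, src_mul, T.boxH.src_inv, ← right_mul h₁,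
    ← left_mul h₁, hid.right]

/-- If `A.Y` is a horizontal identity, then splitting off `Y` on the right of `D` replaces `A` by a
horizontal identity. -/
theorem mul_eq_of_isHorizontalIdentity_right (h₁ : T.boxV.tgt A = T.boxV.src Y)
    (h₂ : T.boxH.tgt Y = T.boxH.tgt D) (h₃ : T.boxV.src D = T.boxV.src Y)
    (hid : T.IsHorizontalIdentity (T.boxV.mul A Y)) :
    T.boxV.mul A D = T.boxV.mul (T.boxH.one (T.boxH.src A)) (T.boxH.mul D (T.boxH.inv Y)) := by
  have h₄ : T.boxV.tgt (T.boxH.one (T.boxH.src A)) =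
      T.boxV.src (T.boxH.mul D (T.boxH.inv Y)) := by
    rw [top_mul (by grind), h₃, top_inv, mul_inv]
    grind
  have h := interchange_mul (A := T.boxH.one (T.boxH.src A)) (C := A)
    (D := T.boxH.mul D (T.boxH.inv Y)) (E := Y) (by grind) (by grind) h₄ h₁
  rw [ArrowGroupoid.one_mul rfl, ArrowGroupoid.inv_mul_cancel_right h₂.symm] at h
  rw [h, hid.eq_one, ArrowGroupoid.mul_one]
  rw [left_mul h₁, right_mul h₄, T.boxH.tgt_one, tgt_mul (by grind), T.boxH.tgt_inv, ← left_mul h₁]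

/-- Among the factorizations `D = X Y`, those with `A.X` and `Y.C` horizontal identities exist only
if `A.D.C` is a horizontal identity, and then `X` is determined by `A` and `D`. -/
theorem isHorizontalIdentity_split_left (hX : T.boxH.src X = T.boxH.src D) :
    ((T.boxV.tgt A = T.boxV.src X ∧ T.IsHorizontalIdentity (T.boxV.mul A X)) ∧
      (T.boxV.tgt (T.boxH.mul (T.boxH.inv X) D) = T.boxV.src C ∧
        T.IsHorizontalIdentity (T.boxV.mul (T.boxH.mul (T.boxH.inv X) D) C))) ↔
    X = T.boxV.mul (T.boxV.inv A) (T.boxH.one (T.ver.mul (T.boxH.src A) (T.boxH.src D))) ∧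
      T.boxV.tgt A = T.boxV.src D ∧ T.boxV.tgt D = T.boxV.src C ∧
      T.IsHorizontalIdentity (T.boxV.mul (T.boxV.mul A D) C) := by
  have hXY : T.boxH.tgt (T.boxH.inv X) = T.boxH.src D := by grind
  constructor
  · rintro ⟨⟨h₁, h₂⟩, h₃, h₄⟩
    have e := h₂.eq_one
    rw [left_mul h₁, hX] at e
    have hYt := h₄.top
    rw [src_mul] at hYt
    have hXb := h₂.bottom
    rw [tgt_mul h₁] at hXb
    have hDb : T.boxV.tgt (T.boxH.mul (T.boxH.inv X) D) = T.boxV.tgt D := by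
      rw [bottom_mul hXY, bottom_inv, hXb, inv_one, ArrowGroupoid.one_mul (by grind)]
    have hD : T.boxV.src D = T.boxV.src X := by
      rw [top_mul hXY, top_inv] at hYt
      rw [← ArrowGroupoid.mul_inv_cancel_left (𝒢 := T.hor) (f := T.boxV.src X)
        (g := T.boxV.src D) (by grind), hYt, ArrowGroupoid.mul_one]
      have := congrArg T.hor.src hYt
      grind
    have hm := mul_eq_of_isHorizontalIdentity_left h₁ hX hD h₂
    have hc : T.boxV.tgt (T.boxH.one (T.boxH.tgt A)) =
        T.boxV.src (T.boxH.mul (T.boxH.inv X) D) := by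
      rw [top_mul hXY, hD, top_inv, inv_mul]
      grind
    refine ⟨?_, by rw [hD, h₁], by rw [← hDb, h₃], ?_⟩
    · rw [← e, ArrowGroupoid.inv_mul_cancel_left h₁]
    · rw [hm, ArrowGroupoid.mul_assoc hc h₃,
        (isHorizontalIdentity_one _).mul_iff_right (by rw [src_mul, hc])]
      exact h₄
  · rintro ⟨hX0, h₁, h₂, h₃⟩
    have hA := h₃.top
    rw [src_mul, src_mul] at hA
    have hc₁ : T.boxV.tgt (T.boxV.inv A) =
        T.boxV.src (T.boxH.one (T.ver.mul (T.boxH.src A) (T.boxH.src D))) := by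
      grind
    have hAX : T.boxV.tgt A = T.boxV.src X := by rw [hX0, src_mul, T.boxV.src_inv]
    have hid : T.IsHorizontalIdentity (T.boxV.mul A X) := by
      rw [hX0, ArrowGroupoid.mul_inv_cancel_left (by grind)]
      exact isHorizontalIdentity_one _
    have hXb := hid.bottom
    rw [tgt_mul hAX] at hXb
    have hDb : T.boxV.tgt (T.boxH.mul (T.boxH.inv X) D) = T.boxV.src C := by
      rw [bottom_mul hXY, bottom_inv, hXb, inv_one, ArrowGroupoid.one_mul (by grind), h₂]
    have hD : T.boxV.src D = T.boxV.src X := by rw [← h₁, hAX]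
    have hc : T.boxV.tgt (T.boxH.one (T.boxH.tgt A)) =
        T.boxV.src (T.boxH.mul (T.boxH.inv X) D) := by
      rw [top_mul hXY, hD, top_inv, inv_mul]
      grind
    refine ⟨⟨hAX, hid⟩, hDb, ?_⟩
    rwa [mul_eq_of_isHorizontalIdentity_left hAX hX hD hid, ArrowGroupoid.mul_assoc hc hDb,
      (isHorizontalIdentity_one _).mul_iff_right (by rw [src_mul, hc])] at h₃

/-- Among the factorizations `D = X Y`, those with `A.Y` and `X.C` horizontal identities exist only
if `A.D.C` is a horizontal identity, and then `Y` is determined by `A` and `D`. -/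
theorem isHorizontalIdentity_split_right (hY : T.boxH.tgt Y = T.boxH.tgt D) :
    ((T.boxV.tgt A = T.boxV.src Y ∧ T.IsHorizontalIdentity (T.boxV.mul A Y)) ∧
      (T.boxV.tgt (T.boxH.mul D (T.boxH.inv Y)) = T.boxV.src C ∧
        T.IsHorizontalIdentity (T.boxV.mul (T.boxH.mul D (T.boxH.inv Y)) C))) ↔
    Y = T.boxV.mul (T.boxV.inv A) (T.boxH.one (T.ver.mul (T.boxH.tgt A) (T.boxH.tgt D))) ∧
      T.boxV.tgt A = T.boxV.src D ∧ T.boxV.tgt D = T.boxV.src C ∧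
      T.IsHorizontalIdentity (T.boxV.mul (T.boxV.mul A D) C) := by
  have hXY : T.boxH.tgt D = T.boxH.src (T.boxH.inv Y) := by grind
  constructor
  · rintro ⟨⟨h₁, h₂⟩, h₃, h₄⟩
    have e := h₂.eq_one
    rw [← h₂.right, right_mul h₁, hY] at e
    have hYt := h₄.top
    rw [src_mul] at hYt
    have hYb := h₂.bottom
    rw [tgt_mul h₁, ← h₂.right] at hYb
    have hDb : T.boxV.tgt (T.boxH.mul D (T.boxH.inv Y)) = T.boxV.tgt D := by
      rw [bottom_mul hXY, bottom_inv, hYb, inv_one, ArrowGroupoid.mul_one (by grind)]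
    have hD : T.boxV.src D = T.boxV.src Y := by
      rw [top_mul hXY, top_inv] at hYt
      rw [← ArrowGroupoid.inv_mul_cancel_right (𝒢 := T.hor) (f := T.boxV.src D)
        (g := T.boxV.src Y) (by grind), hYt, ArrowGroupoid.one_mul]
      have := congrArg T.hor.tgt hYt
      rw [tgt_mul (by grind)] at this
      grind
    have hm := mul_eq_of_isHorizontalIdentity_right h₁ hY hD h₂
    have hc : T.boxV.tgt (T.boxH.one (T.boxH.src A)) =
        T.boxV.src (T.boxH.mul D (T.boxH.inv Y)) := by
      rw [top_mul hXY, hD, top_inv, mul_inv]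
      grind
    refine ⟨?_, by rw [hD, h₁], by rw [← hDb, h₃], ?_⟩
    · rw [← e, ArrowGroupoid.inv_mul_cancel_left h₁]
    · rw [hm, ArrowGroupoid.mul_assoc hc h₃,
        (isHorizontalIdentity_one _).mul_iff_right (by rw [src_mul, hc])]
      exact h₄
  · rintro ⟨hY0, h₁, h₂, h₃⟩
    have hA := h₃.top
    rw [src_mul, src_mul] at hA
    have hc₁ : T.boxV.tgt (T.boxV.inv A) =
        T.boxV.src (T.boxH.one (T.ver.mul (T.boxH.tgt A) (T.boxH.tgt D))) := by
      grind
    have hAY : T.boxV.tgt A = T.boxV.src Y := by rw [hY0, src_mul, T.boxV.src_inv]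
    have hid : T.IsHorizontalIdentity (T.boxV.mul A Y) := by
      rw [hY0, ArrowGroupoid.mul_inv_cancel_left (by grind)]
      exact isHorizontalIdentity_one _
    have hYb := hid.bottom
    rw [tgt_mul hAY] at hYb
    have hDb : T.boxV.tgt (T.boxH.mul D (T.boxH.inv Y)) = T.boxV.src C := by
      rw [bottom_mul hXY, bottom_inv, hYb, inv_one, ArrowGroupoid.mul_one, h₂]
      have := congrArg T.hor.tgt hYb
      grind
    have hD : T.boxV.src D = T.boxV.src Y := by rw [← h₁, hAY]
    have hc : T.boxV.tgt (T.boxH.one (T.boxH.src A)) =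
        T.boxV.src (T.boxH.mul D (T.boxH.inv Y)) := by
      rw [top_mul hXY, hD, top_inv, mul_inv]
      grind
    refine ⟨⟨hAY, hid⟩, hDb, ?_⟩
    rwa [mul_eq_of_isHorizontalIdentity_right hAY hY hD hid, ArrowGroupoid.mul_assoc hc hDb,
      (isHorizontalIdentity_one _).mul_iff_right (by rw [src_mul, hc])] at h₃

namespace BoxAlgebra

variable [Fintype H] [Fintype B]

open Classical in
theorem counit_box (A : B) : Coalgebra.counit (R := k) (box T ϑ A) =
    if T.IsHorizontalIdentity A then (ϑ (T.bl A) : k)⁻¹ else 0 :=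
  counitMap_box T ϑ A

open Classical in
theorem counit_box_mul_box (A C : B) : Coalgebra.counit (R := k) (box T ϑ A * box T ϑ C) =
    if T.boxV.tgt A = T.boxV.src C ∧ T.IsHorizontalIdentity (T.boxV.mul A C)
      then (ϑ (T.bl C) : k)⁻¹ else 0 := by
  by_cases h : T.boxV.tgt A = T.boxV.src C
  · simp only [box_mul_box_of_eq h, counit_box, h, true_and, bl, tgt_mul h]
  · simp only [box_mul_box_of_ne h, map_zero, h, false_and, if_false]

open Classical in
theorem counit_box_mul_box_mul_box (A D C : B) :
    Coalgebra.counit (R := k) (box T ϑ A * box T ϑ D * box T ϑ C) =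
    if T.boxV.tgt A = T.boxV.src D ∧ T.boxV.tgt D = T.boxV.src C ∧
      T.IsHorizontalIdentity (T.boxV.mul (T.boxV.mul A D) C)
      then (ϑ (T.bl C) : k)⁻¹ else 0 := by
  by_cases h : T.boxV.tgt A = T.boxV.src D
  · simp only [box_mul_box_of_eq h, counit_box_mul_box, h, true_and, tgt_mul h]
  · simp only [box_mul_box_of_ne h, zero_mul, map_zero, h, false_and, if_false]

theorem counit_mul_box (A D C : B) :
    Coalgebra.counit (R := k) (box T ϑ A * box T ϑ D * box T ϑ C) =
      LinearMap.mul' k k (TensorProduct.map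
        (Coalgebra.counit (R := k) ∘ₗ LinearMap.mulLeft k (box T ϑ A))
        (Coalgebra.counit (R := k) ∘ₗ LinearMap.mulRight k (box T ϑ C))
        (Coalgebra.comul (R := k) (box T ϑ D))) := by
  classical
  rw [comul_box_left]
  simp only [map_sum, map_smul, TensorProduct.map_tmul, LinearMap.mul'_apply, LinearMap.comp_apply,
    LinearMap.mulLeft_apply, LinearMap.mulRight_apply, smul_eq_mul]
  rw [counit_box_mul_box_mul_box]
  set X₀ := T.boxV.mul (T.boxV.inv A)
    (T.boxH.one (T.ver.mul (T.boxH.src A) (T.boxH.src D))) with hX₀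
  have key : ∀ X ∈ Finset.univ.filter fun X => T.boxH.src X = T.boxH.src D,
      (ϑ (T.br X) : k) * (Coalgebra.counit (R := k) (box T ϑ A * box T ϑ X) *
        Coalgebra.counit (R := k) (box T ϑ (T.boxH.mul (T.boxH.inv X) D) * box T ϑ C)) =
      if X = X₀ then (if T.boxV.tgt A = T.boxV.src D ∧ T.boxV.tgt D = T.boxV.src C ∧
        T.IsHorizontalIdentity (T.boxV.mul (T.boxV.mul A D) C)
        then (ϑ (T.bl C) : k)⁻¹ else 0) else 0 := by
    intro X hX
    simp only [Finset.mem_filter, Finset.mem_univ, true_and] at hX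
    rw [counit_box_mul_box, counit_box_mul_box, ite_zero_mul_ite_zero, ← ite_and, mul_ite, mul_zero]
    refine if_ctx_congr (isHorizontalIdentity_split_left hX) (fun h => ?_) fun _ => rfl
    obtain ⟨⟨h₁, h₂⟩, -⟩ := (isHorizontalIdentity_split_left hX).2 h
    have hb := h₂.bottom
    rw [tgt_mul h₁] at hb
    -- The bottom of `X` is that of the identity `A.X`, so that the weights of `X` cancel.
    have : T.br X = T.bl X := by rw [br, bl, hb, T.hor.tgt_one, T.hor.src_one]
    rw [this, mul_inv_cancel_left₀ (Units.ne_zero _)]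
  rw [Finset.sum_congr rfl key, Finset.sum_ite_eq']
  symm
  simp only [Finset.mem_filter, Finset.mem_univ, true_and, ite_eq_left_iff]
  intro h
  rw [if_neg]
  rintro ⟨h₁, h₂, h₃⟩
  have hA := h₃.top
  rw [src_mul, src_mul] at hA
  refine h ?_
  rw [hX₀, left_mul (by grind), left_inv, T.boxH.src_one,
    ArrowGroupoid.inv_mul_cancel_left (by grind)]

theorem counit_mul_box' (A D C : B) :
    Coalgebra.counit (R := k) (box T ϑ A * box T ϑ D * box T ϑ C) =
      LinearMap.mul' k k (TensorProduct.map
        (Coalgebra.counit (R := k) ∘ₗ LinearMap.mulRight k (box T ϑ C))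
        (Coalgebra.counit (R := k) ∘ₗ LinearMap.mulLeft k (box T ϑ A))
        (Coalgebra.comul (R := k) (box T ϑ D))) := by
  classical
  rw [comul_box_right]
  simp only [map_sum, map_smul, TensorProduct.map_tmul, LinearMap.mul'_apply, LinearMap.comp_apply,
    LinearMap.mulLeft_apply, LinearMap.mulRight_apply, smul_eq_mul]
  rw [counit_box_mul_box_mul_box]
  set Y₀ := T.boxV.mul (T.boxV.inv A)
    (T.boxH.one (T.ver.mul (T.boxH.tgt A) (T.boxH.tgt D))) with hY₀
  have key : ∀ Y ∈ Finset.univ.filter fun Y => T.boxH.tgt Y = T.boxH.tgt D,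
      (ϑ (T.bl Y) : k) * (Coalgebra.counit (R := k)
          (box T ϑ (T.boxH.mul D (T.boxH.inv Y)) * box T ϑ C) *
        Coalgebra.counit (R := k) (box T ϑ A * box T ϑ Y)) =
      if Y = Y₀ then (if T.boxV.tgt A = T.boxV.src D ∧ T.boxV.tgt D = T.boxV.src C ∧
        T.IsHorizontalIdentity (T.boxV.mul (T.boxV.mul A D) C)
        then (ϑ (T.bl C) : k)⁻¹ else 0) else 0 := by
    intro Y hY
    simp only [Finset.mem_filter, Finset.mem_univ, true_and] at hY
    rw [_root_.mul_comm (Coalgebra.counit (R := k) _), counit_box_mul_box, counit_box_mul_box,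
      ite_zero_mul_ite_zero, ← ite_and, mul_ite, mul_zero,
      mul_inv_cancel_left₀ (Units.ne_zero _)]
    exact if_congr (isHorizontalIdentity_split_right hY) rfl rfl
  rw [Finset.sum_congr rfl key, Finset.sum_ite_eq']
  symm
  simp only [Finset.mem_filter, Finset.mem_univ, true_and, ite_eq_left_iff]
  intro h
  rw [if_neg]
  rintro ⟨h₁, h₂, h₃⟩
  have hA := h₃.top
  rw [src_mul, src_mul] at hA
  refine h ?_
  have hA' : T.ver.src (T.boxH.tgt A) = T.ver.src (T.boxH.src (T.boxV.mul (T.boxV.mul A D) C)) := by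
    rw [← T.topRight, hA, T.hor.tgt_one]
  have hAD : T.ver.tgt (T.boxH.tgt A) = T.ver.src (T.boxH.tgt D) := by
    rw [← T.bottomRight, h₁, T.topRight]
  rw [hY₀, right_mul (by grind), right_inv, T.boxH.tgt_one,
    ArrowGroupoid.inv_mul_cancel_left hAD]

theorem counit_mul (a b c : BoxAlgebra T ϑ) :
    Coalgebra.counit (R := k) (a * b * c) =
      LinearMap.mul' k k (TensorProduct.map
        (Coalgebra.counit (R := k) ∘ₗ LinearMap.mulLeft k a)
        (Coalgebra.counit (R := k) ∘ₗ LinearMap.mulRight k c)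
        (Coalgebra.comul (R := k) b)) := by
  induction a using box_induction with
  | zero => simp
  | add x y hx hy =>
    rw [add_mul, add_mul, map_add, hx, hy, LinearMap.mulLeft_add, LinearMap.comp_add,
      TensorProduct.map_add_left,
      LinearMap.add_apply, map_add]
  | smul r A =>
    induction b using box_induction with
    | zero => simp
    | add x y hx hy => simp only [mul_add, add_mul, map_add, hx, hy]
    | smul s D =>
      induction c using box_induction with
      | zero => simp
      | add x y hx hy =>
        rw [mul_add, map_add, hx, hy, LinearMap.mulRight_add, LinearMap.comp_add,
          TensorProduct.map_add_right, LinearMap.add_apply, map_add]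
      | smul t C =>
        rw [LinearMap.mulLeft_smul, LinearMap.mulRight_smul, LinearMap.comp_smul,
          LinearMap.comp_smul, TensorProduct.map_smul_left, TensorProduct.map_smul_right]
        simp only [smul_mul_assoc, mul_smul_comm, map_smul,
          LinearMap.smul_apply, counit_mul_box, smul_eq_mul]
        ring

theorem counit_mul' (a b c : BoxAlgebra T ϑ) :
    Coalgebra.counit (R := k) (a * b * c) =
      LinearMap.mul' k k (TensorProduct.map
        (Coalgebra.counit (R := k) ∘ₗ LinearMap.mulRight k c)
        (Coalgebra.counit (R := k) ∘ₗ LinearMap.mulLeft k a)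
        (Coalgebra.comul (R := k) b)) := by
  induction a using box_induction with
  | zero => simp
  | add x y hx hy =>
    rw [add_mul, add_mul, map_add, hx, hy, LinearMap.mulLeft_add, LinearMap.comp_add,
      TensorProduct.map_add_right,
      LinearMap.add_apply, map_add]
  | smul r A =>
    induction b using box_induction with
    | zero => simp
    | add x y hx hy => simp only [mul_add, add_mul, map_add, hx, hy]
    | smul s D =>
      induction c using box_induction with
      | zero => simp
      | add x y hx hy =>
        rw [mul_add, map_add, hx, hy, LinearMap.mulRight_add, LinearMap.comp_add,
          TensorProduct.map_add_left, LinearMap.add_apply, map_add]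
      | smul t C =>
        rw [LinearMap.mulLeft_smul, LinearMap.mulRight_smul, LinearMap.comp_smul,
          LinearMap.comp_smul, TensorProduct.map_smul_left, TensorProduct.map_smul_right]
        simp only [smul_mul_assoc, mul_smul_comm, map_smul,
          LinearMap.smul_apply, counit_mul_box', smul_eq_mul]
        ring

theorem isWeakBialgebra (hn : T.Normalized ϑ) : IsWeakBialgebra k (BoxAlgebra T ϑ) where
  comul_mul := comul_mul hn
  comul_one := comul_one
  comul_one' := comul_one'
  counit_mul := counit_mul
  counit_mul' := counit_mul'

end BoxAlgebra
end DoubleGroupoid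

/-! ### The source and target maps -/

section SourceTarget

variable (k : Type*) (A : Type*) [Field k] [Ring A] [Algebra k A] [Coalgebra k A]

/-- The target map, as a linear map. -/
noncomputable def targetLinearMap : A →ₗ[k] A :=
  (TensorProduct.lid k A).toLinearMap ∘ₗ (Coalgebra.counit (R := k) (A := A)).rTensor A ∘ₗ
    LinearMap.mulLeft k (Coalgebra.comul (R := k) (1 : A)) ∘ₗ (TensorProduct.mk k A A).flip 1

/-- The source map, as a linear map. -/
noncomputable def sourceLinearMap : A →ₗ[k] A :=
  (TensorProduct.rid k A).toLinearMap ∘ₗ (Coalgebra.counit (R := k) (A := A)).lTensor A ∘ₗ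
    LinearMap.mulRight k (Coalgebra.comul (R := k) (1 : A)) ∘ₗ TensorProduct.mk k A A 1

variable {k A}

theorem targetLinearMap_apply (h : A) : targetLinearMap k A h = targetMap k h := rfl

theorem sourceLinearMap_apply (h : A) : sourceLinearMap k A h = sourceMap k h := rfl

theorem targetMap_eq_sum {ι : Type*} [Fintype ι] {c : ι → k} {a b : ι → A}
    (h1 : Coalgebra.comul (R := k) (1 : A) = ∑ i, c i • (a i ⊗ₜ[k] b i)) (h : A) :
    targetMap k h = ∑ i, (c i * Coalgebra.counit (R := k) (a i * h)) • b i := by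
  simp [targetMap, h1, Finset.sum_mul, smul_smul]

theorem sourceMap_eq_sum {ι : Type*} [Fintype ι] {c : ι → k} {a b : ι → A}
    (h1 : Coalgebra.comul (R := k) (1 : A) = ∑ i, c i • (a i ⊗ₜ[k] b i)) (h : A) :
    sourceMap k h = ∑ i, (c i * Coalgebra.counit (R := k) (h * b i)) • a i := by
  simp [sourceMap, h1, Finset.mul_sum, smul_smul]

end SourceTarget

namespace DoubleGroupoid

open ArrowGroupoid

variable {P V H B : Type*} {T : DoubleGroupoid P V H B} {k : Type*} [Field k] {ϑ : P → kˣ}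
  {A X Y : B}

theorem vertical_inv_mul {A C : B} (h : T.boxH.tgt A = T.boxH.src C) :
    T.boxV.inv (T.boxH.mul A C) = T.boxH.mul (T.boxV.inv A) (T.boxV.inv C) :=
  horizontal_inv_mul (T := T.transpose) h

namespace BoxAlgebra

variable [Fintype H] [Fintype B]

open Classical in
/-- In `ε_t(A) = ∑ ϑ(br X) ε(X.A) rightComplement X`, the complement of `X` vanishes unless the left
side of `X` is an identity, which leaves only the box `X` with `X.A` the identity of the left side
of `A`. -/
theorem targetMap_box (A : B) : targetMap k (box T ϑ A) =
    if T.boxV.tgt A = T.hor.one (T.bl A) then ((ϑ (T.tr A) : k) / ϑ (T.bl A)) •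
      rightComplement T ϑ (T.boxV.mul (T.boxH.one (T.boxH.src A)) (T.boxV.inv A)) else 0 := by
  rw [targetMap_eq_sum comul_one_eq_sum_left]
  set X₀ := T.boxV.mul (T.boxH.one (T.boxH.src A)) (T.boxV.inv A) with hX₀
  rw [Finset.sum_eq_single X₀]
  · rw [counit_box_mul_box]
    split_ifs with h₁ h₂ h₂
    · rw [div_eq_mul_inv]
      congr 3
      rw [br, h₁.1, tr]
    · refine absurd ?_ h₂
      have := h₁.2.bottom
      rw [tgt_mul h₁.1] at this
      rw [this, bl, this, T.hor.src_one]
    · refine absurd ?_ h₁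
      have hc : T.boxV.tgt (T.boxH.one (T.boxH.src A)) = T.boxV.src (T.boxV.inv A) := by
        rw [T.bottom_one, T.boxV.src_inv, h₂, bl, T.bottomLeft]
      refine ⟨by rw [hX₀, tgt_mul hc, T.boxV.tgt_inv], ?_⟩
      rw [hX₀, ArrowGroupoid.inv_mul_cancel_right (by grind)]
      exact isHorizontalIdentity_one _
    · rw [mul_zero, zero_smul]
  · intro X _ hX
    rw [counit_box_mul_box]
    split_ifs with h
    · rw [rightComplement, Finset.filter_false_of_mem, Finset.sum_empty, smul_zero]
      intro x _ hx
      refine hX ?_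
      have e := h.2.eq_one
      rw [left_mul h.1, hx, ArrowGroupoid.one_mul] at e
      · rw [hX₀, ← e, ArrowGroupoid.mul_inv_cancel_right h.1]
      · have := T.bottomLeft X
        rw [h.1, T.topLeft, hx, T.ver.tgt_one] at this
        exact this.symm
    · rw [mul_zero, zero_smul]
  · simp

open Classical in
/-- In `ε_s(A) = ∑ ϑ(bl Z) ε(A.Z) leftComplement Z`, the complement of `Z` vanishes unless the right
side of `Z` is an identity, which leaves only the box `Z` with `A.Z` the identity of the right side
of `A`. -/
theorem sourceMap_box (A : B) : sourceMap k (box T ϑ A) =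
    if T.boxV.src A = T.hor.one (T.tr A) then
      leftComplement T ϑ (T.boxV.mul (T.boxV.inv A) (T.boxH.one (T.boxH.tgt A))) else 0 := by
  rw [sourceMap_eq_sum comul_one_eq_sum_right]
  set Z₀ := T.boxV.mul (T.boxV.inv A) (T.boxH.one (T.boxH.tgt A)) with hZ₀
  rw [Finset.sum_eq_single Z₀]
  · rw [counit_box_mul_box]
    split_ifs with h₁ h₂ h₂
    · rw [mul_inv_cancel₀ (Units.ne_zero _), one_smul]
    · refine absurd ?_ h₂
      have := h₁.2.top
      rw [src_mul] at this
      rw [this, tr, this, T.hor.tgt_one]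
    · refine absurd ?_ h₁
      have hc : T.boxV.tgt (T.boxV.inv A) = T.boxV.src (T.boxH.one (T.boxH.tgt A)) := by
        rw [T.top_one, T.boxV.tgt_inv, h₂, tr, T.topRight]
      refine ⟨by rw [hZ₀, src_mul, T.boxV.src_inv], ?_⟩
      rw [hZ₀, ArrowGroupoid.mul_inv_cancel_left (by grind)]
      exact isHorizontalIdentity_one _
    · rw [mul_zero, zero_smul]
  · intro Z _ hZ
    rw [counit_box_mul_box]
    split_ifs with h
    · rw [leftComplement, Finset.filter_false_of_mem, Finset.sum_empty, smul_zero]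
      intro x _ hx
      refine hZ ?_
      have e := h.2.eq_one
      rw [← h.2.right, right_mul h.1, hx, ArrowGroupoid.mul_one] at e
      · rw [hZ₀, ← e, ArrowGroupoid.inv_mul_cancel_left h.1]
      · have := T.bottomRight A
        rw [h.1, T.topRight, hx, T.ver.src_one] at this
        exact this
    · rw [mul_zero, zero_smul]
  · simp

end BoxAlgebra
end DoubleGroupoid

/-! ### The antipode -/

namespace DoubleGroupoid

open ArrowGroupoid

variable {P V H B : Type*} {T : DoubleGroupoid P V H B} {k : Type*} [Field k] {ϑ : P → kˣ}
  {A X Y : B}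

/-- Let `⁻¹` be the inverse for both compositions. If `A` has an identity at the bottom and `A = X Y`,
then `X.Y⁻¹` depends on `Y` only through its top side. -/
theorem mul_inv_eq (hA : T.boxV.tgt A = T.hor.one (T.bl A)) (hY : T.boxH.tgt Y = T.boxH.tgt A) :
    T.boxV.mul (T.boxH.mul A (T.boxH.inv Y)) (T.boxV.inv (T.boxH.inv Y)) =
      T.boxH.mul
        (T.boxH.inv (T.boxV.mul (T.boxH.one (T.boxH.src A)) (T.boxV.inv A)))
        (T.boxV.one (T.hor.mul (T.boxV.src A) (T.hor.inv (T.boxV.src Y)))) := by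
  have hl : T.bl A = T.ver.tgt (T.boxH.src A) := T.bottomLeft A
  have hr : T.bl A = T.ver.tgt (T.boxH.tgt A) := by
    rw [← T.bottomRight, hA, T.hor.tgt_one]
  rw [hl] at hA
  have h₁ : T.boxV.mul A (T.boxH.one (T.ver.inv (T.boxH.tgt A))) =
      T.boxH.mul (T.boxH.inv (T.boxV.mul (T.boxH.one (T.boxH.src A)) (T.boxV.inv A)))
        (T.boxV.one (T.boxV.src A)) := by
    rw [horizontal_inv_mul (by grind), ArrowGroupoid.inv_one, ← ArrowGroupoid.mul_inv (𝒢 := T.boxV),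
      ← interchange_mul (by grind) (by grind) (by grind) (by grind), ArrowGroupoid.one_mul rfl,
      ArrowGroupoid.inv_mul, right_inv]
  have h₂ : T.boxV.inv (T.boxH.inv Y) =
      T.boxH.mul (T.boxH.one (T.ver.inv (T.boxH.tgt A))) (T.boxV.inv (T.boxH.inv Y)) := by
    rw [ArrowGroupoid.one_mul (by grind)]
  rw [h₂, interchange_mul (by grind) (by grind) (by grind) (by grind), h₁,
    ArrowGroupoid.mul_inv (𝒢 := T.boxV), top_inv, one_mul_hor (by grind),
    ArrowGroupoid.mul_assoc (by grind) (by grind)]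

/-- If `A` has an identity on top and `A = X Y`, then `X⁻¹.Y` depends on `X` only through its
bottom side. -/
theorem inv_mul_eq (hA : T.boxV.src A = T.hor.one (T.tr A)) (hX : T.boxH.src X = T.boxH.src A) :
    T.boxV.mul (T.boxV.inv (T.boxH.inv X)) (T.boxH.mul (T.boxH.inv X) A) =
      T.boxH.mul (T.boxV.one (T.hor.mul (T.hor.inv (T.boxV.tgt X)) (T.boxV.tgt A)))
        (T.boxH.inv (T.boxV.mul (T.boxV.inv A) (T.boxH.one (T.boxH.tgt A)))) := by
  have hr : T.tr A = T.ver.src (T.boxH.tgt A) := T.topRight A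
  have hl : T.tr A = T.ver.src (T.boxH.src A) := by
    rw [← T.topLeft, hA, T.hor.src_one]
  rw [hr] at hA
  have h₁ : T.boxV.mul (T.boxH.one (T.ver.inv (T.boxH.src A))) A =
      T.boxH.mul (T.boxV.one (T.boxV.tgt A))
        (T.boxH.inv (T.boxV.mul (T.boxV.inv A) (T.boxH.one (T.boxH.tgt A)))) := by
    rw [horizontal_inv_mul (by grind), ArrowGroupoid.inv_one, ← ArrowGroupoid.inv_mul (𝒢 := T.boxV),
      ← interchange_mul (by grind) (by grind) (by grind) (by grind), ArrowGroupoid.mul_one rfl,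
      ArrowGroupoid.mul_inv, left_inv]
  have h₂ : T.boxV.inv (T.boxH.inv X) =
      T.boxH.mul (T.boxV.inv (T.boxH.inv X)) (T.boxH.one (T.ver.inv (T.boxH.src A))) := by
    rw [ArrowGroupoid.mul_one (by grind)]
  rw [h₂, interchange_mul (by grind) (by grind) (by grind) (by grind), h₁,
    ArrowGroupoid.inv_mul (𝒢 := T.boxV), bottom_inv, one_mul_hor (by grind),
    ← ArrowGroupoid.mul_assoc (by grind) (by grind)]

/-- For `A = X Y` where `Y` has an identity at the bottom, the inverse of `A` is the product of
`X⁻¹` with the box of `ε_t(Y)` that is vertically composable with it. -/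
theorem inv_mul_target_eq (hY : T.boxV.tgt Y = T.hor.one (T.bl Y))
    (hX : T.boxH.tgt X = T.boxH.src Y) :
    T.boxV.mul (T.boxV.inv (T.boxH.inv X)) (T.boxH.mul
        (T.boxH.inv (T.boxV.mul (T.boxH.one (T.boxH.src Y)) (T.boxV.inv Y)))
        (T.boxV.one (T.hor.inv (T.boxV.src X)))) =
      T.boxV.inv (T.boxH.inv (T.boxH.mul X Y)) := by
  have hl : T.bl Y = T.ver.tgt (T.boxH.src Y) := T.bottomLeft Y
  have hr : T.bl Y = T.ver.tgt (T.boxH.tgt Y) := by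
    rw [← T.bottomRight, hY, T.hor.tgt_one]
  rw [hl] at hY
  have h₁ : T.boxV.inv (T.boxH.inv X) =
      T.boxH.mul (T.boxH.one (T.ver.inv (T.boxH.src Y))) (T.boxV.inv (T.boxH.inv X)) := by
    rw [ArrowGroupoid.one_mul (by grind)]
  rw [h₁, horizontal_inv_mul (by grind), ArrowGroupoid.inv_one,
    interchange_mul (by grind) (by grind) (by grind) (by grind), one_inv_ver,
    ArrowGroupoid.inv_mul_cancel_left (by grind), ArrowGroupoid.mul_one (by grind),
    ArrowGroupoid.inv_mul_rev hX, vertical_inv_mul (by grind), ← inv_comm (A := Y)]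

namespace BoxAlgebra

variable (T ϑ) in
/-- The antipode: the inverse of a box for both compositions, multiplied by the character. -/
noncomputable def antipode : BoxAlgebra T ϑ →ₗ[k] BoxAlgebra T ϑ :=
  (basis T ϑ).constr k fun A => T.character ϑ A • box T ϑ (T.boxV.inv (T.boxH.inv A))

theorem antipode_box (A : B) :
    antipode T ϑ (box T ϑ A) = T.character ϑ A • box T ϑ (T.boxV.inv (T.boxH.inv A)) := by
  rw [antipode, box, Module.Basis.constr_basis]

variable [Fintype H] [Fintype B]

/-- The axiom `h₁ S(h₂) = ε_t(h)`. -/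
theorem mul_lTensor_antipode_comul (hn : T.Normalized ϑ) (h : BoxAlgebra T ϑ) :
    LinearMap.mul' k _ ((antipode T ϑ).lTensor _ (Coalgebra.comul (R := k) h)) =
      targetMap k h := by
  classical
  rw [← targetLinearMap_apply]
  change (LinearMap.mul' k _ ∘ₗ (antipode T ϑ).lTensor _ ∘ₗ Coalgebra.comul (R := k)) h = _
  congr 1
  refine (basis T ϑ).ext fun A => ?_
  change LinearMap.mul' k _ ((antipode T ϑ).lTensor _ (Coalgebra.comul (R := k) (box T ϑ A))) =
    targetMap k (box T ϑ A)
  rw [comul_box_right, targetMap_box]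
  simp only [map_sum, map_smul, LinearMap.lTensor_tmul, LinearMap.mul'_apply, antipode_box,
    mul_smul_comm, smul_smul]
  split_ifs with hA
  · have hr : T.bl A = T.br A := by rw [br, hA, T.hor.tgt_one]
    set X₀ := T.boxV.mul (T.boxH.one (T.boxH.src A)) (T.boxV.inv A) with hX₀
    have hl : T.boxH.src X₀ = T.ver.one (T.hor.src (T.boxV.src A)) := by
      have hc : T.boxV.tgt (T.boxH.one (T.boxH.src A)) = T.boxV.src (T.boxV.inv A) := by
        rw [T.bottom_one, T.boxV.src_inv, hA, bl, T.bottomLeft]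
      rw [hX₀, left_mul hc, T.boxH.src_one, left_inv, ArrowGroupoid.mul_inv, T.topLeft]
    -- The summand of `Y` belongs to the arrow `x = t(A) t(Y)⁻¹`.
    calc
      _ = ∑ Y : B with T.boxH.tgt Y = T.boxH.tgt A,
          ∑ x : H with T.boxH.src X₀ = T.ver.one (T.hor.src x) ∧
              T.boxV.src Y = T.hor.mul (T.hor.inv x) (T.boxV.src A),
            ((ϑ (T.tr A) : k) / ϑ (T.bl A) * ϑ (T.bl Y)) •
              box T ϑ (T.boxH.mul (T.boxH.inv X₀) (T.boxV.one x)) := by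
        refine Finset.sum_congr rfl fun Y hY => ?_
        simp only [Finset.mem_filter, Finset.mem_univ, true_and] at hY
        have ht : T.hor.tgt (T.boxV.src A) = T.hor.tgt (T.boxV.src Y) := by grind
        rw [Finset.sum_eq_single (T.hor.mul (T.boxV.src A) (T.hor.inv (T.boxV.src Y))),
          box_mul_box_of_eq, mul_inv_eq hA hY]
        · congr 1
          have h₁ : T.tr Y = T.tr A := by rw [tr, tr, ht]
          have h₂ : T.br Y = T.br A := by simp only [br]; grind
          rw [character, h₁, h₂, hr, mul_comm]
        · rw [bottom_mul (by grind), hA, T.boxV.src_inv, ArrowGroupoid.one_mul]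
          rw [bottom_inv, T.hor.src_inv, hr, br]; grind
        · intro x hx hne
          simp only [Finset.mem_filter, Finset.mem_univ, true_and] at hx
          refine absurd ?_ hne
          have hx' : T.hor.src x = T.hor.src (T.boxV.src A) := by
            rw [hl] at hx; exact (one_injective hx.1).symm
          rw [hx.2, ArrowGroupoid.inv_mul_rev (by grind), ArrowGroupoid.inv_inv,
            ArrowGroupoid.mul_inv_cancel_left hx'.symm]
        · intro hx
          simp only [Finset.mem_filter, Finset.mem_univ, true_and] at hx
          refine absurd ⟨by rw [hl, src_mul], ?_⟩ hx
          rw [ArrowGroupoid.inv_mul_rev (by grind), ArrowGroupoid.inv_inv,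
            ArrowGroupoid.inv_mul_cancel_right (by grind)]
      _ = ∑ x : H with T.boxH.src X₀ = T.ver.one (T.hor.src x),
          ∑ Y : B with T.boxV.src Y = T.hor.mul (T.hor.inv x) (T.boxV.src A) ∧
              T.boxH.tgt Y = T.boxH.tgt A,
            ((ϑ (T.tr A) : k) / ϑ (T.bl A) * ϑ (T.bl Y)) •
              box T ϑ (T.boxH.mul (T.boxH.inv X₀) (T.boxV.one x)) := by
        refine Finset.sum_comm' fun Y x => ?_
        simp only [Finset.mem_filter, Finset.mem_univ, true_and]
        tauto
      _ = _ := by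
        rw [rightComplement, Finset.smul_sum]
        refine Finset.sum_congr rfl fun x hx => ?_
        simp only [Finset.mem_filter, Finset.mem_univ, true_and] at hx
        have hx' : T.hor.src x = T.hor.src (T.boxV.src A) := by
          rw [hl] at hx; exact (one_injective hx).symm
        rw [← Finset.sum_smul, ← Finset.mul_sum, hn.sum_bl, _root_.mul_one]
        rw [tgt_mul (by grind), T.topRight]
  · refine Finset.sum_eq_zero fun Y hY => ?_
    simp only [Finset.mem_filter, Finset.mem_univ, true_and] at hY
    rw [box_mul_box_of_ne, smul_zero]
    intro h
    refine hA ?_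
    rw [bottom_mul (by grind), T.boxV.src_inv, bottom_inv] at h
    have h' := ArrowGroupoid.mul_inv_cancel_right (𝒢 := T.hor) (f := T.boxV.tgt A)
      (g := T.hor.inv (T.boxV.tgt Y)) (by grind)
    rw [h, ArrowGroupoid.mul_inv] at h'
    rw [← h', bl, ← h', T.hor.src_one]

/-- The axiom `S(h₁) h₂ = ε_s(h)`. -/
theorem mul_rTensor_antipode_comul (hn : T.Normalized ϑ) (h : BoxAlgebra T ϑ) :
    LinearMap.mul' k _ ((antipode T ϑ).rTensor _ (Coalgebra.comul (R := k) h)) =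
      sourceMap k h := by
  classical
  rw [← sourceLinearMap_apply]
  change (LinearMap.mul' k _ ∘ₗ (antipode T ϑ).rTensor _ ∘ₗ Coalgebra.comul (R := k)) h = _
  congr 1
  refine (basis T ϑ).ext fun A => ?_
  change LinearMap.mul' k _ ((antipode T ϑ).rTensor _ (Coalgebra.comul (R := k) (box T ϑ A))) =
    sourceMap k (box T ϑ A)
  rw [comul_box_left, sourceMap_box]
  simp only [map_sum, map_smul, LinearMap.rTensor_tmul, LinearMap.mul'_apply, antipode_box,
    smul_mul_assoc, smul_smul]
  split_ifs with hA
  · set Z₀ := T.boxV.mul (T.boxV.inv A) (T.boxH.one (T.boxH.tgt A)) with hZ₀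
    have hr : T.boxH.tgt Z₀ = T.ver.one (T.hor.tgt (T.boxV.tgt A)) := by
      have hc : T.boxV.tgt (T.boxV.inv A) = T.boxV.src (T.boxH.one (T.boxH.tgt A)) := by
        rw [T.top_one, T.boxV.tgt_inv, hA, tr, T.topRight]
      rw [hZ₀, right_mul hc, T.boxH.tgt_one, right_inv, ArrowGroupoid.inv_mul, T.bottomRight]
    -- The summand of `X` belongs to the arrow `y = b(X)⁻¹ b(A)`.
    calc
      _ = ∑ X : B with T.boxH.src X = T.boxH.src A,
          ∑ y : H with T.boxH.tgt Z₀ = T.ver.one (T.hor.tgt y) ∧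
              T.boxV.tgt X = T.hor.mul (T.boxV.tgt A) (T.hor.inv y),
            (ϑ (T.tr X) : k) •
              box T ϑ (T.boxH.mul (T.boxV.one y) (T.boxH.inv Z₀)) := by
        refine Finset.sum_congr rfl fun X hX => ?_
        simp only [Finset.mem_filter, Finset.mem_univ, true_and] at hX
        have ht : T.hor.src (T.boxV.tgt A) = T.hor.src (T.boxV.tgt X) := by grind
        rw [Finset.sum_eq_single (T.hor.mul (T.hor.inv (T.boxV.tgt X)) (T.boxV.tgt A)),
          box_mul_box_of_eq, inv_mul_eq hA hX]
        · congr 1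
          rw [character, mul_div_cancel₀ _ (Units.ne_zero _)]
        · rw [top_mul (by grind), hA, T.boxV.tgt_inv, ArrowGroupoid.mul_one]
          have := congrArg T.hor.src hA
          grind
        · intro y hy hne
          simp only [Finset.mem_filter, Finset.mem_univ, true_and] at hy
          refine absurd ?_ hne
          have hy' : T.hor.tgt y = T.hor.tgt (T.boxV.tgt A) := by
            rw [hr] at hy; exact (one_injective hy.1).symm
          rw [hy.2, ArrowGroupoid.inv_mul_rev (by grind), ArrowGroupoid.inv_inv,
            ArrowGroupoid.inv_mul_cancel_right hy']
        · intro hy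
          simp only [Finset.mem_filter, Finset.mem_univ, true_and] at hy
          refine absurd ⟨by rw [hr, tgt_mul (by grind)], ?_⟩ hy
          rw [ArrowGroupoid.inv_mul_rev (by grind), ArrowGroupoid.inv_inv,
            ArrowGroupoid.mul_inv_cancel_left (by grind)]
      _ = ∑ y : H with T.boxH.tgt Z₀ = T.ver.one (T.hor.tgt y),
          ∑ X : B with T.boxH.src X = T.boxH.src A ∧
              T.boxV.tgt X = T.hor.mul (T.boxV.tgt A) (T.hor.inv y),
            (ϑ (T.tr X) : k) •
              box T ϑ (T.boxH.mul (T.boxV.one y) (T.boxH.inv Z₀)) := by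
        refine Finset.sum_comm' fun Y x => ?_
        simp only [Finset.mem_filter, Finset.mem_univ, true_and]
        tauto
      _ = _ := by
        rw [leftComplement]
        refine Finset.sum_congr rfl fun y hy => ?_
        rw [← Finset.sum_smul, hn.sum_tr, one_smul]
        rw [src_mul, T.bottomLeft]
  · refine Finset.sum_eq_zero fun X hX => ?_
    simp only [Finset.mem_filter, Finset.mem_univ, true_and] at hX
    rw [box_mul_box_of_ne, smul_zero]
    intro h
    refine hA ?_
    rw [top_mul (by grind), T.boxV.tgt_inv, top_inv] at h
    have h' := ArrowGroupoid.inv_mul_cancel_left (𝒢 := T.hor) (f := T.hor.inv (T.boxV.src X))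
      (g := T.boxV.src A) (by grind)
    rw [← h, ArrowGroupoid.inv_mul] at h'
    rw [← h', tr, ← h', T.hor.tgt_one]

/-- The axiom `S(h₁) h₂ S(h₃) = S(h)`, in the form `S(h₁) ε_t(h₂) = S(h)`: for a box `A`, only the
factorizations `A = X Y` with `b(X) = b(A)` contribute, and each contributes a multiple of `A⁻¹`. -/
theorem antipode_mul_target (hn : T.Normalized ϑ) (h : BoxAlgebra T ϑ) :
    LinearMap.mul' k _ (TensorProduct.map (antipode T ϑ)
      (LinearMap.mul' k _ ∘ₗ (antipode T ϑ).lTensor _ ∘ₗ Coalgebra.comul (R := k))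
      (Coalgebra.comul (R := k) h)) = antipode T ϑ h := by
  classical
  have htarget : LinearMap.mul' k _ ∘ₗ (antipode T ϑ).lTensor _ ∘ₗ Coalgebra.comul (R := k) =
      targetLinearMap k (BoxAlgebra T ϑ) := LinearMap.ext (mul_lTensor_antipode_comul hn)
  rw [htarget]
  change (LinearMap.mul' k _ ∘ₗ TensorProduct.map (antipode T ϑ) (targetLinearMap k _) ∘ₗ
    Coalgebra.comul (R := k)) h = _
  congr 1
  refine (basis T ϑ).ext fun A => ?_
  change LinearMap.mul' k _ (TensorProduct.map (antipode T ϑ) (targetLinearMap k _)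
    (Coalgebra.comul (R := k) (box T ϑ A))) = antipode T ϑ (box T ϑ A)
  rw [comul_box_left]
  simp only [map_sum, map_smul, TensorProduct.map_tmul, LinearMap.mul'_apply, antipode_box,
    targetLinearMap_apply, targetMap_box]
  calc
    _ = ∑ X : B with T.boxH.src X = T.boxH.src A ∧ T.boxV.tgt X = T.boxV.tgt A,
        (ϑ (T.tr X) * T.character ϑ A : k) • box T ϑ (T.boxV.inv (T.boxH.inv A)) := by
      rw [← Finset.filter_filter, Finset.sum_filter (fun X => T.boxV.tgt X = T.boxV.tgt A)]
      refine Finset.sum_congr rfl fun X hX => ?_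
      simp only [Finset.mem_filter, Finset.mem_univ, true_and] at hX
      have hXY : T.boxH.tgt (T.boxH.inv X) = T.boxH.src A := by grind
      have hbl := bl_inv_mul hX
      set Y := T.boxH.mul (T.boxH.inv X) A with hY
      have hYb : T.boxV.tgt Y = T.hor.mul (T.hor.inv (T.boxV.tgt X)) (T.boxV.tgt A) := by
        rw [hY, bottom_mul hXY, bottom_inv]
      have hiff : T.boxV.tgt Y = T.hor.one (T.bl Y) ↔ T.boxV.tgt X = T.boxV.tgt A := by
        rw [hYb, hbl, br]
        constructor
        · intro h
          rw [← ArrowGroupoid.mul_inv_cancel_left (𝒢 := T.hor) (f := T.boxV.tgt X)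
            (g := T.boxV.tgt A) (by grind), h, ArrowGroupoid.mul_one rfl]
        · intro h
          rw [← h, ArrowGroupoid.inv_mul]
      by_cases hXA : T.boxV.tgt X = T.boxV.tgt A
      · have hc : T.boxH.tgt X = T.boxH.src Y := by rw [hY, src_mul, T.boxH.src_inv]
        have hone := hiff.2 hXA
        rw [if_pos hone, if_pos hXA]
        have hprod : box T ϑ (T.boxV.inv (T.boxH.inv X)) * rightComplement T ϑ
            (T.boxV.mul (T.boxH.one (T.boxH.src Y)) (T.boxV.inv Y)) =
            box T ϑ (T.boxV.inv (T.boxH.inv A)) := by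
          have hXYA : T.boxH.mul X Y = A := ArrowGroupoid.mul_inv_cancel_left hX
          have hm := inv_mul_target_eq hone hc
          rw [hXYA] at hm
          have hc' : T.boxV.tgt (T.boxH.one (T.boxH.src Y)) = T.boxV.src (T.boxV.inv Y) := by
            rw [T.bottom_one, T.boxV.src_inv, hone, bl, T.bottomLeft]
          set Y₀ := T.boxV.mul (T.boxH.one (T.boxH.src Y)) (T.boxV.inv Y) with hY₀
          have hl : T.boxH.src Y₀ = T.ver.one (T.hor.src (T.boxV.src Y)) := by
            rw [hY₀, left_mul hc', T.boxH.src_one, left_inv, ArrowGroupoid.mul_inv, T.topLeft]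
          have ht : T.boxV.src Y₀ = T.hor.one (T.ver.src (T.boxH.src Y)) := by
            rw [hY₀, src_mul, T.top_one]
          have htop : ∀ x : H, T.boxH.src Y₀ = T.ver.one (T.hor.src x) →
              T.boxV.src (T.boxH.mul (T.boxH.inv Y₀) (T.boxV.one x)) = x := by
            intro x hx
            rw [top_mul (by grind), top_inv, ht, ArrowGroupoid.inv_one, T.boxV.src_one,
              ArrowGroupoid.one_mul]
            rw [hl] at hx
            rw [← one_injective hx, T.topLeft]
          have hx₀ : T.boxH.src Y₀ = T.ver.one (T.hor.src (T.hor.inv (T.boxV.src X))) := by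
            rw [hl, T.hor.src_inv, T.topLeft, T.topRight, hc]
          rw [rightComplement, Finset.mul_sum,
            Finset.sum_eq_single (T.hor.inv (T.boxV.src X)), box_mul_box_of_eq, hm]
          · rw [htop _ hx₀, T.boxV.tgt_inv, top_inv]
          · intro x hx hne
            simp only [Finset.mem_filter, Finset.mem_univ, true_and] at hx
            rw [box_mul_box_of_ne]
            rw [htop x hx, T.boxV.tgt_inv, top_inv]
            exact hne.symm
          · intro hx
            simp only [Finset.mem_filter, Finset.mem_univ, true_and] at hx
            exact absurd hx₀ hx
        rw [smul_mul_smul_comm, hprod, smul_smul]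
        congr 1
        have h₁ : T.tr Y = T.tr A := by
          simp only [tr]; rw [hY]; grind
        have h₂ : T.br X = T.br A := by rw [br, hXA, br]
        rw [hbl, h₁, h₂, character, character, h₂]
        have := (ϑ (T.br A)).ne_zero
        field_simp
      · rw [if_neg (mt hiff.1 hXA), if_neg hXA, mul_zero, smul_zero]
    _ = _ := by
      rw [← Finset.sum_smul, ← Finset.sum_mul, hn.sum_tr (T.bottomLeft A).symm, _root_.one_mul]

theorem isWeakHopfAlgebra (hn : T.Normalized ϑ) : IsWeakHopfAlgebra k (BoxAlgebra T ϑ) where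
  toIsWeakBialgebra := isWeakBialgebra hn
  exists_antipode := ⟨antipode T ϑ, mul_lTensor_antipode_comul hn, mul_rTensor_antipode_comul hn,
    antipode_mul_target hn⟩

end BoxAlgebra
end DoubleGroupoid

/-! ### The left regular representation -/

/-- If the left multiplications form a `*`-representation for some inner product on a
finite-dimensional `*`-algebra, then the regular representation is a faithful `*`-representation on
a Hilbert space. -/
theorem exists_faithful_starRepresentation {A : Type u} [Ring A] [Algebra ℂ A] [StarRing A]
    [StarModule ℂ A] [FiniteDimensional ℂ A] (c : InnerProductSpace.Core ℂ A)
    (hc : ∀ a x y, c.inner (a * x) y = c.inner x (star a * y)) :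
    ∃ (K : Type u) (_ : NormedAddCommGroup K) (_ : InnerProductSpace ℂ K)
      (_ : CompleteSpace K) (π : A →⋆ₐ[ℂ] (K →L[ℂ] K)), Function.Injective π := by
  let _ : NormedAddCommGroup A := c.toNormedAddCommGroup
  let _ : InnerProductSpace ℂ A := InnerProductSpace.ofCore c.toCore
  have hcomplete : CompleteSpace A := FiniteDimensional.complete ℂ A
  refine ⟨A, inferInstance, inferInstance, hcomplete,
    { toFun := fun a => LinearMap.toContinuousLinearMap (LinearMap.mulLeft ℂ a)
      map_one' := by ext; simp
      map_mul' := fun a b => by ext; simp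
      map_zero' := by ext; simp
      map_add' := fun a b => by ext; simp [add_mul]
      commutes' := fun r => by ext; simp [Algebra.algebraMap_eq_smul_one]
      map_star' := fun a => ?_ }, ?_⟩
  · rw [ContinuousLinearMap.star_eq_adjoint, ContinuousLinearMap.eq_adjoint_iff]
    intro x y
    have h := hc (star a) x y
    rw [star_star] at h
    exact h
  · intro a b h
    have h' := DFunLike.congr_fun h (1 : A)
    simpa using h'

namespace DoubleGroupoid

open ArrowGroupoid
open scoped ComplexConjugate

variable {P V H B : Type*} {T : DoubleGroupoid P V H B}

theorem character_inv {k : Type*} [Field k] {ϑ : P → kˣ} (A : B) :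
    T.character ϑ (T.boxV.inv A) = (T.character ϑ A)⁻¹ := by
  simp only [character, tr, br, T.boxV.src_inv, T.boxV.tgt_inv, inv_div]

theorem character_mul {k : Type*} [Field k] {ϑ : P → kˣ} {A C : B}
    (h : T.boxV.tgt A = T.boxV.src C) :
    T.character ϑ (T.boxV.mul A C) = T.character ϑ A * T.character ϑ C := by
  simp only [character, tr, br, src_mul, tgt_mul h, h]
  rw [div_mul_div_cancel₀ (Units.ne_zero _)]

theorem character_ne_zero {k : Type*} [Field k] {ϑ : P → kˣ} (A : B) :
    T.character ϑ A ≠ 0 :=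
  div_ne_zero (Units.ne_zero _) (Units.ne_zero _)

variable {ϑ : P → ℂˣ}

theorem exists_character_eq (hϑ : ∀ p, ∃ r : ℝ, 0 < r ∧ (ϑ p : ℂ) = r) (A : B) :
    ∃ r : ℝ, 0 < r ∧ T.character ϑ A = r := by
  obtain ⟨r, hr, h⟩ := hϑ (T.tr A)
  obtain ⟨s, hs, h'⟩ := hϑ (T.br A)
  exact ⟨r / s, div_pos hr hs, by rw [character, h, h', Complex.ofReal_div]⟩

namespace BoxAlgebra

/-! ### The involution and the inner product -/

variable (T ϑ) in
/-- The conjugate-linear map with `A ↦ λ(A) A^v` on boxes. -/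
noncomputable def involution [Fintype B] (a : BoxAlgebra T ϑ) : BoxAlgebra T ϑ :=
  ∑ A : B, (conj ((basis T ϑ).repr a A) * T.character ϑ A) • box T ϑ (T.boxV.inv A)

theorem involution_add [Fintype B] (a b : BoxAlgebra T ϑ) :
    involution T ϑ (a + b) = involution T ϑ a + involution T ϑ b := by
  simp only [involution, map_add, Finsupp.add_apply, add_mul, add_smul, Finset.sum_add_distrib]

theorem involution_smul [Fintype B] (c : ℂ) (a : BoxAlgebra T ϑ) :
    involution T ϑ (c • a) = conj c • involution T ϑ a := by
  simp only [involution, map_smul, Finsupp.smul_apply, smul_eq_mul, map_mul, Finset.smul_sum,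
    smul_smul, _root_.mul_assoc]

theorem involution_zero [Fintype B] : involution T ϑ 0 = 0 := by
  simp [involution]

theorem involution_box [Fintype B] (A : B) :
    involution T ϑ (box T ϑ A) = T.character ϑ A • box T ϑ (T.boxV.inv A) := by
  classical
  rw [involution, Finset.sum_eq_single A]
  · simp [box]
  · intro C _ hC
    simp [box, hC.symm]
  · simp

theorem conj_character (hϑ : ∀ p, ∃ r : ℝ, 0 < r ∧ (ϑ p : ℂ) = r) (A : B) :
    conj (T.character ϑ A) = T.character ϑ A := by
  obtain ⟨r, -, h⟩ := T.exists_character_eq hϑ A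
  rw [h, Complex.conj_ofReal]

theorem character_re_pos (hϑ : ∀ p, ∃ r : ℝ, 0 < r ∧ (ϑ p : ℂ) = r) (A : B) :
    0 < (T.character ϑ A).re := by
  obtain ⟨r, hr, h⟩ := T.exists_character_eq hϑ A
  rwa [h, Complex.ofReal_re]

open Classical in
theorem functional_box (A : B) :
    functional T ϑ (box T ϑ A) = if T.IsVerticalIdentity A then 1 else 0 := by
  rw [functional, box, Module.Basis.constr_basis]

/-- An inner product on the box algebra is determined by its values on boxes. -/
theorem innerCore_ext {T : DoubleGroupoid P V H B}
    {c c' : InnerProductSpace.Core ℂ (BoxAlgebra T ϑ)}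
    (h : ∀ A C : B, c.inner (box T ϑ A) (box T ϑ C) = c'.inner (box T ϑ A) (box T ϑ C)) :
    c = c' := by
  have key : c.inner = c'.inner := by
    funext a b
    induction a using box_induction with
    | zero =>
      rw [← zero_smul ℂ (0 : BoxAlgebra T ϑ), c.smul_left, c'.smul_left, map_zero, zero_mul,
        zero_mul]
    | add x y hx hy => rw [c.add_left, c'.add_left, hx, hy]
    | smul r A =>
      rw [c.smul_left, c'.smul_left]
      congr 1
      rw [← c.conj_inner_symm, ← c'.conj_inner_symm]
      congr 1
      induction b using box_induction with
      | zero =>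
        rw [← zero_smul ℂ (0 : BoxAlgebra T ϑ), c.smul_left, c'.smul_left, map_zero, zero_mul,
          zero_mul]
      | add x y hx hy => rw [c.add_left, c'.add_left, hx, hy]
      | smul s C => rw [c.smul_left, c'.smul_left, h]
  obtain ⟨⟨⟨i⟩, _, _, _, _⟩, _⟩ := c
  obtain ⟨⟨⟨i'⟩, _, _, _, _⟩, _⟩ := c'
  obtain rfl : i = i' := key
  rfl

variable [Fintype H]

open Classical in
theorem functional_star_box_mul_box [StarRing (BoxAlgebra T ϑ)]
    (hs : ∀ A : B, star (box T ϑ A) = T.character ϑ A • box T ϑ (T.boxV.inv A)) (A C : B) :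
    functional T ϑ (star (box T ϑ A) * box T ϑ C) = if A = C then T.character ϑ A else 0 := by
  rw [hs, smul_mul_assoc, map_smul, smul_eq_mul]
  by_cases h : T.boxV.src A = T.boxV.src C
  · rw [box_mul_box_of_eq (by rw [T.boxV.tgt_inv, h]), functional_box, mul_ite, _root_.mul_one,
      mul_zero]
    congr 1
    refine propext ⟨?_, ?_⟩
    · rintro ⟨x, hx⟩
      rw [eq_inv_of_mul_eq_one (by rw [T.boxV.tgt_inv, h]) hx, ArrowGroupoid.inv_inv]
    · rintro rfl
      exact ⟨_, ArrowGroupoid.inv_mul⟩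
  · rw [box_mul_box_of_ne (by rwa [T.boxV.tgt_inv]), map_zero, mul_zero, if_neg]
    rintro rfl
    exact h rfl

variable [Fintype B]

/-- The involution makes the box algebra a `*`-ring when `ϑ` is real. -/
noncomputable abbrev starRing (T : DoubleGroupoid P V H B)
    (hϑ : ∀ p, ∃ r : ℝ, 0 < r ∧ (ϑ p : ℂ) = r) : StarRing (BoxAlgebra T ϑ) where
  star := involution T ϑ
  star_involutive a := by
    induction a using box_induction with
    | zero => simp only [involution_zero]
    | add x y hx hy => simp only [involution_add, hx, hy]
    | smul c A =>
      have := character_ne_zero (T := T) (ϑ := ϑ) A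
      simp only [involution_smul, involution_box, conj_character hϑ, Complex.conj_conj,
        character_inv, smul_smul, mul_inv_cancel_right₀ this, map_mul,
        ArrowGroupoid.inv_inv]
  star_mul a b := by
    induction a using box_induction with
    | zero => simp only [zero_mul, mul_zero, involution_zero]
    | add x y hx hy => simp only [add_mul, mul_add, involution_add, hx, hy]
    | smul c A =>
      induction b using box_induction with
      | zero => simp only [zero_mul, mul_zero, involution_zero]
      | add x y hx hy => simp only [add_mul, mul_add, involution_add, hx, hy]
      | smul d C =>
        simp only [smul_mul_smul_comm, involution_smul, involution_box]
        by_cases h : T.boxV.tgt A = T.boxV.src C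
        · have h' : T.boxV.tgt (T.boxV.inv C) = T.boxV.src (T.boxV.inv A) := by grind
          rw [box_mul_box_of_eq h, box_mul_box_of_eq h', involution_box, inv_mul_rev h,
            character_mul h, smul_smul, smul_smul, map_mul]
          congr 1
          ring
        · have h' : T.boxV.tgt (T.boxV.inv C) ≠ T.boxV.src (T.boxV.inv A) := by
            rw [T.boxV.tgt_inv, T.boxV.src_inv]
            exact fun e => h e.symm
          rw [box_mul_box_of_ne h, box_mul_box_of_ne h', involution_zero, smul_zero, smul_zero,
            smul_zero]
  star_add := involution_add

section Star

variable [StarRing (BoxAlgebra T ϑ)] [StarModule ℂ (BoxAlgebra T ϑ)]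

/-- The factorizations of `A^v` are the `X^v Y^v` with `A = X Y`, and
`λ(X) ϑ(br X) = ϑ(tr X) = ϑ(br X^v)`. -/
theorem comul_star (hϑ : ∀ p, ∃ r : ℝ, 0 < r ∧ (ϑ p : ℂ) = r)
    (hs : ∀ A : B, star (box T ϑ A) = T.character ϑ A • box T ϑ (T.boxV.inv A))
    (a : BoxAlgebra T ϑ) :
    Coalgebra.comul (R := ℂ) (star a) = star (Coalgebra.comul (R := ℂ) a) := by
  classical
  induction a using box_induction with
  | zero => simp
  | add x y hx hy => simp only [star_add, map_add, hx, hy]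
  | smul c A =>
    simp only [star_smul, map_smul]
    congr 1
    rw [hs, map_smul, comul_box_left, comul_box_left, Finset.smul_sum, star_sum]
    refine Finset.sum_nbij' T.boxV.inv T.boxV.inv ?_ ?_ ?_ ?_ ?_
    all_goals simp only [Finset.mem_filter, Finset.mem_univ, true_and]
    · grind
    · grind
    · intros; exact ArrowGroupoid.inv_inv
    · intros; exact ArrowGroupoid.inv_inv
    · intro X hX
      have hc : T.boxH.tgt (T.boxH.inv (T.boxV.inv X)) = T.boxH.src A := by grind
      have h₁ : T.boxV.inv (T.boxH.mul (T.boxH.inv (T.boxV.inv X)) A) =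
          T.boxH.mul (T.boxH.inv X) (T.boxV.inv A) := by
        rw [vertical_inv_mul hc, inv_comm, ArrowGroupoid.inv_inv]
      have h₂ : T.character ϑ (T.boxH.mul (T.boxH.inv (T.boxV.inv X)) A) = T.character ϑ A := by
        have ht : T.tr (T.boxH.mul (T.boxH.inv (T.boxV.inv X)) A) = T.tr A := by
          simp only [tr]; grind
        have hb : T.br (T.boxH.mul (T.boxH.inv (T.boxV.inv X)) A) = T.br A := by
          simp only [br]; grind
        rw [character, character, ht, hb]
      have h₃ : T.br (T.boxV.inv X) = T.tr X := by rw [br, tr, T.boxV.tgt_inv]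
      have h₄ : conj (ϑ (T.tr X) : ℂ) = ϑ (T.tr X) := by
        obtain ⟨r, -, hr⟩ := hϑ (T.tr X)
        rw [hr, Complex.conj_ofReal]
      rw [star_smul, TensorProduct.star_tmul, hs, hs, h₁, h₂, h₃, ArrowGroupoid.inv_inv,
        TensorProduct.smul_tmul_smul, smul_smul, smul_smul, character_inv, ← starRingEnd_apply, h₄]
      congr 1
      rw [character, character]
      have := (ϑ (T.tr X)).ne_zero
      have := (ϑ (T.br X)).ne_zero
      field_simp

/-- In the basis of boxes, `φ(a^* b)` is the diagonal form with the weights `λ(A)`. -/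
theorem functional_star_mul
    (hs : ∀ A : B, star (box T ϑ A) = T.character ϑ A • box T ϑ (T.boxV.inv A))
    (a b : BoxAlgebra T ϑ) :
    functional T ϑ (star a * b) =
      ∑ A : B, conj ((basis T ϑ).repr a A) * (basis T ϑ).repr b A * T.character ϑ A := by
  classical
  induction a using box_induction with
  | zero => simp
  | add x y hx hy =>
    simp only [star_add, add_mul, map_add, hx, hy, Finsupp.add_apply, Finset.sum_add_distrib]
  | smul c A =>
    induction b using box_induction with
    | zero => simp
    | add x y hx hy =>
      simp only [mul_add, add_mul, map_add, hx, hy, Finsupp.add_apply, Finset.sum_add_distrib]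
    | smul d C =>
      rw [star_smul, smul_mul_smul_comm, map_smul, functional_star_box_mul_box hs,
        Finset.sum_eq_single A]
      · by_cases h : A = C
        · subst h
          simp [box]
        · simp [box, h]
      · intro D _ hD
        simp [box, Finsupp.single_apply, hD.symm]
      · simp

theorem functional_star_mul_self (hϑ : ∀ p, ∃ r : ℝ, 0 < r ∧ (ϑ p : ℂ) = r)
    (hs : ∀ A : B, star (box T ϑ A) = T.character ϑ A • box T ϑ (T.boxV.inv A))
    (a : BoxAlgebra T ϑ) :
    functional T ϑ (star a * a) =
      ((∑ A : B, Complex.normSq ((basis T ϑ).repr a A) * (T.character ϑ A).re : ℝ) : ℂ) := by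
  rw [functional_star_mul hs, Complex.ofReal_sum]
  refine Finset.sum_congr rfl fun A _ => ?_
  obtain ⟨r, -, h⟩ := T.exists_character_eq hϑ A
  rw [h, Complex.ofReal_re, Complex.ofReal_mul, Complex.normSq_eq_conj_mul_self]

variable (T) in
/-- The inner product `(a|b) = φ(a^* b)`. -/
noncomputable abbrev innerCore (hϑ : ∀ p, ∃ r : ℝ, 0 < r ∧ (ϑ p : ℂ) = r)
    (hs : ∀ A : B, star (box T ϑ A) = T.character ϑ A • box T ϑ (T.boxV.inv A)) :
    InnerProductSpace.Core ℂ (BoxAlgebra T ϑ) where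
  inner a b := functional T ϑ (star a * b)
  conj_inner_symm a b := by
    simp only [functional_star_mul hs, map_sum, map_mul, Complex.conj_conj, conj_character hϑ]
    exact Finset.sum_congr rfl fun A _ => by ring
  re_inner_nonneg a := by
    rw [functional_star_mul_self hϑ hs]
    exact Finset.sum_nonneg fun A _ =>
      mul_nonneg (Complex.normSq_nonneg _) (character_re_pos hϑ A).le
  add_left a b c := by rw [star_add, add_mul, map_add]
  smul_left a b r := by
    rw [star_smul, smul_mul_assoc, map_smul, smul_eq_mul]
    rfl
  definite a h := by
    rw [functional_star_mul_self hϑ hs, Complex.ofReal_eq_zero, Finset.sum_eq_zero_iff_of_nonneg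
      fun A _ => mul_nonneg (Complex.normSq_nonneg _) (character_re_pos hϑ A).le] at h
    refine (basis T ϑ).ext_elem fun A => ?_
    have := h A (Finset.mem_univ A)
    rw [mul_eq_zero, or_iff_left (character_re_pos hϑ A).ne', Complex.normSq_eq_zero] at this
    rw [this, map_zero, Finsupp.zero_apply]

end Star

end BoxAlgebra
end DoubleGroupoid

open DoubleGroupoid BoxAlgebra in
theorem mainTheorem12 {P V H B : Type*} [Fintype H] [Fintype B] (T : DoubleGroupoid P V H B)
    (ϑ : P → ℂˣ) (hϑ : ∀ p, ∃ r : ℝ, 0 < r ∧ (ϑ p : ℂ) = r) (hnorm : T.Normalized ϑ) :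
    ∃ (_ : StarRing (BoxAlgebra T ϑ)) (_ : StarModule ℂ (BoxAlgebra T ϑ)),
      (∀ A : B, star (box T ϑ A) = T.character ϑ A • box T ϑ (T.boxV.inv A)) ∧
      IsCStarQuantumGroupoid (BoxAlgebra T ϑ) ∧
      (∀ a : BoxAlgebra T ϑ, 0 ≤ (functional T ϑ (star a * a)).re ∧
        (functional T ϑ (star a * a)).im = 0) ∧
      ∃ c : InnerProductSpace.Core ℂ (BoxAlgebra T ϑ),
        (∀ a b, c.inner a b = functional T ϑ (star a * b)) ∧
        (∀ c' : InnerProductSpace.Core ℂ (BoxAlgebra T ϑ),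
          (∀ A C : B, c'.inner (box T ϑ A) (box T ϑ C) =
            functional T ϑ (star (box T ϑ A) * box T ϑ C)) → c' = c) ∧
        (∀ a x y, c.inner (a * x) y = c.inner x (star a * y)) := by
  let _ : StarRing (BoxAlgebra T ϑ) := starRing T hϑ
  have hmod : StarModule ℂ (BoxAlgebra T ϑ) := ⟨fun r a => involution_smul r a⟩
  have hs : ∀ A : B, star (box T ϑ A) = T.character ϑ A • box T ϑ (T.boxV.inv A) :=
    involution_box
  have hc : ∀ a x y, (innerCore T hϑ hs).inner (a * x) y =
      (innerCore T hϑ hs).inner x (star a * y) := fun a x y => by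
    change functional T ϑ (star (a * x) * y) = functional T ϑ (star x * (star a * y))
    rw [star_mul, mul_assoc]
  have hfin : FiniteDimensional ℂ (BoxAlgebra T ϑ) := (basis T ϑ).finiteDimensional_of_finite
  refine ⟨inferInstance, hmod, hs, ⟨isWeakHopfAlgebra hnorm, hfin, comul_star hϑ hs,
    exists_faithful_starRepresentation (innerCore T hϑ hs) hc⟩, fun a => ?_,
    innerCore T hϑ hs, fun _ _ => rfl, fun c' h' => innerCore_ext h', hc⟩
  rw [functional_star_mul_self hϑ hs, Complex.ofReal_re, Complex.ofReal_im]
  exact ⟨Finset.sum_nonneg fun A _ =>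
    mul_nonneg (Complex.normSq_nonneg _) (character_re_pos hϑ A).le, rfl⟩
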